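/- A $k$-graph is a pair $(X,\mathscr M)$ with $X$ a finite set and $\mathscr M$ a set of $k$-element subsets of $X$. A sub-$k$-graph of $(X,\mathscr M)$ is a $k$-graph $(X',\mathscr M')$ with $X'\subseteq X$ and $\mathscr M'\subseteq\mathscr M$ (not necessarily induced); it is proper if $(X',\mathscr M')\neq(X,\mathscr M)$. A $k$-graph is asymmetric if the identity is its only automorphism, and an involution is a non-identity automorphism $\phi$ with $\phi\circ\phi=\mathrm{id}$. For $m\ge 4$ let $G_m$ be the $m$-graph with vertices $v_1,\dots,v_{2m-1}$ and edges $M_i=\{v_i,v_{i+1},\dots,v_{i+m-1}\}$, $1\le i\le m$, and let $G^*_m$ be obtained from $G_m$ by adding one vertex $x$ and the edge $M_{m+1}=\{x,v_1,\dots,v_{m-2},v_{m+2}\}$. The last two vertices of $G_m$ are $v_{2m-2}$ and $v_{2m-1}$. For $k\ge 6$ and $s\ge 0$ the $k$-graph $G_{k,s}$ is built from pairwise disjoint blocks on layers $1,\dots,s+2$. Layer $s+2$ consists of one copy of $G^*_{k-2}$. For each $l=s+1,s,\dots,1$, layer $l$ has exactly one block for each edge of each block on layer $l+1$; this block is a copy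 of $G_{k-2}$ if $l\ge 2$ and a copy of $G_k$ if $l=1$. The vertices of $G_{k,s}$ are all vertices of the blocks. The edges of $G_{k,s}$ are the edges of the blocks on layer $1$ and, for each edge $M$ of a block on a layer $l+1\ge 2$, the set consisting of $M$ and the last two vertices of the block on layer $l$ that corresponds to $M$. **Theorem.** For every integer $k\ge 6$ there are infinitely many pairwise non-isomorphic $k$-graphs $(X,\mathscr M)$ such that 1. $(X,\mathscr M)$ is asymmetric, and 2. every proper sub-$k$-graph of $(X,\mathscr M)$ with at least two vertices has an involution. More precisely, for every $k\ge 6$ the hypergraphs $G_{k,s}$, $s=0,1,2,\dots$, are pairwise non-isomorphic $k$-graphs, and each of them has the properties 1 and 2. -/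

import Mathlib

namespace Hypergraph

open scoped Hypergraph

/-- `H` is a (finite) `k`-graph: finitely many vertices, every edge has exactly `k` elements. -/
def IsKGraph {α : Type*} (H : Hypergraph α) (k : ℕ) : Prop :=
  V(H).Finite ∧ ∀ e ∈ E(H), e.ncard = k

/-- The bijection `φ` between the vertex sets is an isomorphism: a set of vertices is an edge
of `H` if and only if its image is an edge of `K`. -/
def IsIso {α β : Type*} {H : Hypergraph α} {K : Hypergraph β} (φ : V(H) ≃ V(K)) : Prop :=
  ∀ e : Set V(H), Subtype.val '' e ∈ E(H) ↔ Subtype.val '' (φ '' e) ∈ E(K)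

/-- `H` and `K` are isomorphic. -/
def Isomorphic {α β : Type*} (H : Hypergraph α) (K : Hypergraph β) : Prop :=
  ∃ φ : V(H) ≃ V(K), IsIso φ

/-- The only automorphism of `H` is the identity. -/
def IsAsymmetric {α : Type*} (H : Hypergraph α) : Prop :=
  ∀ φ : V(H) ≃ V(H), IsIso φ → φ = Equiv.refl _

/-- `H` has a non-identity automorphism `φ` with `φ ∘ φ = id`. -/
def HasInvolution {α : Type*} (H : Hypergraph α) : Prop :=
  ∃ φ : V(H) ≃ V(H), IsIso φ ∧ φ ≠ Equiv.refl _ ∧ ∀ v, φ (φ v) = v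

/-- `H` is a (not necessarily induced) subhypergraph of `G`. -/
def IsSubhypergraph {α : Type*} (H G : Hypergraph α) : Prop :=
  V(H) ⊆ V(G) ∧ E(H) ⊆ E(G)

/-! ### The blocks `G_m` and `G*_m`

The vertex `v_j` is the number `j`, the additional vertex `x` of `G*_m` is the number `0`. -/

/-- The vertices `v_1, …, v_{2m-1}` of `G_m`. -/
def blockVerts (m : ℕ) : Set ℕ := Set.Icc 1 (2 * m - 1)

/-- The edge `M_i = {v_i, …, v_{i+m-1}}` of `G_m`, to be used for `1 ≤ i ≤ m`. -/
def blockEdge (m i : ℕ) : Set ℕ := Set.Icc i (i + m - 1)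

/-- The vertices `x, v_1, …, v_{2m-1}` of `G*_m`. -/
def starVerts (m : ℕ) : Set ℕ := insert 0 (blockVerts m)

/-- The edges of `G*_m`, numbered by `1, …, m + 1`: the edges `M_1, …, M_m` of `G_m`, and
`M* = {x, v_1, …, v_{m-2}, v_{m+2}}` as number `m + 1`. -/
def starEdge (m i : ℕ) : Set ℕ :=
  if i = m + 1 then insert 0 (insert (m + 2) (Set.Icc 1 (m - 2))) else blockEdge m i

/-! ### The layered composition `G_{k,s}`

The copies of the blocks are indexed by lists: `[i_l, i_{l+1}, …, i_{s+1}]` is the copy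
`G(i_l, …, i_{s+1})` on layer `l`, for `1 ≤ l ≤ s + 1`, and `[]` is the copy of `G*_{k-2}` on
layer `s + 2`. So a list of length `s + 1` is a copy of `G_k` on layer `1`, and the lists of
length `1, …, s` are the copies of `G_{k-2}`. -/

/-- The number of edges of the copy `p`. -/
def copyNumEdges (k s : ℕ) (p : List ℕ) : ℕ :=
  if p = [] then k - 1 else if p.length = s + 1 then k else k - 2

/-- The vertices of the copy `p`. -/
def copyVerts (k s : ℕ) (p : List ℕ) : Set ℕ :=
  if p = [] then starVerts (k - 2) else if p.length = s + 1 then blockVerts k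
  else blockVerts (k - 2)

/-- The `i`-th edge of the copy `p`, before it is enlarged. -/
def copyEdge (k s : ℕ) (p : List ℕ) (i : ℕ) : Set ℕ :=
  if p = [] then starEdge (k - 2) i else if p.length = s + 1 then blockEdge k i
  else blockEdge (k - 2) i

/-- The last two vertices `v_{2m-2}, v_{2m-1}` of the copy `p ≠ []`, which is a copy of `G_m`
with `m = k` on layer `1` and `m = k - 2` above it. -/
def copyLastTwo (k s : ℕ) (p : List ℕ) : Set ℕ :=
  if p.length = s + 1 then {2 * k - 2, 2 * k - 1} else {2 * (k - 2) - 2, 2 * (k - 2) - 1}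

/-- `IsCopy k s p`: the list `p` is the index of a copy. Below layer `s + 2` there is one copy
`i :: p` on the next lower layer for each edge number `i` of a copy `p` that is not on layer `1`. -/
inductive IsCopy (k s : ℕ) : List ℕ → Prop
  | nil : IsCopy k s []
  | cons (i : ℕ) (p : List ℕ) : IsCopy k s p → p.length ≤ s → 1 ≤ i → i ≤ copyNumEdges k s p →
      IsCopy k s (i :: p)

/-- The edge of `G_{k,s}` that comes from the `i`-th edge of the copy `p`: on layer `1` it is this
edge itself, on higher layers it is enlarged by the last two vertices of the copy `i :: p`. -/
def layeredEdge (k s : ℕ) (p : List ℕ) (i : ℕ) : Set (List ℕ × ℕ) :=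
  Prod.mk p '' copyEdge k s p i ∪
    if p.length = s + 1 then ∅ else Prod.mk (i :: p) '' copyLastTwo k s (i :: p)

theorem IsCopy.length_le {k s : ℕ} {p : List ℕ} (h : IsCopy k s p) : p.length ≤ s + 1 := by
  cases h with
  | nil => simp
  | cons i p _ hl _ _ => simpa using hl

/-- The layered composition `G_{k,s}`; the pair `(p, j)` is the vertex number `j` of the
copy `p`. -/
def layered (k s : ℕ) (hk : 6 ≤ k) : Hypergraph (List ℕ × ℕ) where
  vertexSet := {x | IsCopy k s x.1 ∧ x.2 ∈ copyVerts k s x.1}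
  edgeSet := {e | ∃ p i, IsCopy k s p ∧ 1 ≤ i ∧ i ≤ copyNumEdges k s p ∧ e = layeredEdge k s p i}
  subset_vertexSet_of_mem_edgeSet' := by
    rintro e ⟨p, i, hp, hi, hi', rfl⟩ x (⟨j, hj, rfl⟩ | hx)
    · refine ⟨hp, ?_⟩
      simp only [copyEdge, copyVerts, copyNumEdges, starEdge, starVerts, blockEdge,
        blockVerts] at *
      split_ifs at * <;> simp only [Set.mem_insert_iff, Set.mem_Icc] at * <;> omega
    · split_ifs at hx with h
      · exact hx.elim
      · obtain ⟨j, hj, rfl⟩ := hx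
        have hl := hp.length_le
        refine ⟨.cons i p hp (by omega) hi hi', ?_⟩
        simp only [copyLastTwo, copyVerts, blockVerts, reduceCtorEq, if_false] at *
        split_ifs at * <;>
          simp only [Set.mem_insert_iff, Set.mem_singleton_iff, Set.mem_Icc] at * <;> omega

end Hypergraph

/-! Write `m` for the size of a block. Two symmetries of `G_m` drive the proof: reversal `v_j ↦
v_{2m-j}`, which exchanges `M_i` and `M_{m+1-i}`, and the fact that deleting a single edge makes two
neighbouring vertices twins.

Minimality. Let `H` be a subhypergraph without an involution. Twins would give an involution, so a
copy below the top layer keeps all its edges or none (`hasEdge_of_hasEdge`). If it keeps all while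
the edge it is attached to is missing, the copy can be reversed together with everything below it;
if it keeps none while that edge is present, its last two vertices are twins. Hence everything below
an edge is present or absent with that edge (`isUniformBelow`), and any symmetry of what remains of
the top copy extends to `H` (`hasInvolution_of_blockMap`). Every nonempty proper set of edges of
`G*_{k-2}` leaves twins or such a symmetry, so all top edges are present, and then `H` is
everything. If no top edge is present, `H` has no edges and any two vertices are twins.

Asymmetry. No two vertices lie in the same edges, so it suffices that an automorphism fixes every
edge. The edge from `M*` is the only one whose vertices all have degree below `k - 2`. Starting from
it, the last edge `M_m` of the top copy is recognised (`IsIso.mapEdge_nil_lastEdge`). In any copy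
`M_m` determines the other `M_i`: they pass through the centre `v_m`, the only vertex of `M_m` of
degree at least `m`, and meet `M_m` in `i` vertices (`IsIso.mapEdge_of_lastEdge`). The last edge of
a child is the one meeting its fixed parent edge in the last two vertices, so fixedness descends
through the layers (`IsIso.mapEdge_child_lastEdge`).

Non-isomorphism follows because the number of vertices grows strictly with `s`. -/

namespace Hypergraph

open scoped Hypergraph

/-! ### Uniform description of the copies -/

/-- The size `m` of the block `G_m` (or `G*_m`) of which `p` is a copy. -/
def copySize (k s : ℕ) (p : List ℕ) : ℕ := if p.length = s + 1 then k else k - 2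

/-- The pair `(p, i)` is the index of an edge of `G_{k,s}`. -/
def IsEdgeIndex (k s : ℕ) (p : List ℕ) (i : ℕ) : Prop :=
  IsCopy k s p ∧ 1 ≤ i ∧ i ≤ copyNumEdges k s p

section Copies

variable {k s : ℕ} {p q : List ℕ} {i j : ℕ}

theorem four_le_copySize (hk : 6 ≤ k) : 4 ≤ copySize k s p := by
  unfold copySize; split_ifs <;> omega

theorem sub_two_le_copySize : k - 2 ≤ copySize k s p := by
  unfold copySize; split_ifs <;> omega

theorem copySize_nil : copySize k s [] = k - 2 := by simp [copySize]

theorem copyNumEdges_nil : copyNumEdges k s [] = k - 1 := by simp [copyNumEdges]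

theorem copyNumEdges_of_ne_nil (hp : p ≠ []) : copyNumEdges k s p = copySize k s p := by
  simp [copyNumEdges, copySize, hp]

theorem copyNumEdges_congr (h : p.length = q.length) :
    copyNumEdges k s p = copyNumEdges k s q := by
  simp [copyNumEdges, ← List.length_eq_zero_iff, h]

theorem copyEdge_congr (h : p.length = q.length) : copyEdge k s p i = copyEdge k s q i := by
  simp [copyEdge, ← List.length_eq_zero_iff, h]

theorem copyLastTwo_congr (h : p.length = q.length) :
    copyLastTwo k s p = copyLastTwo k s q := by
  simp [copyLastTwo, h]

theorem copySize_le_copyNumEdges : copySize k s p ≤ copyNumEdges k s p := by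
  unfold copySize copyNumEdges
  grind

theorem mem_copyEdge (hi : 1 ≤ i) (him : i ≤ copySize k s p) :
    j ∈ copyEdge k s p i ↔ i ≤ j ∧ j < i + copySize k s p := by
  unfold copyEdge copySize starEdge blockEdge at *
  split_ifs at * <;> simp_all <;> omega

theorem mem_copyEdge_star (hk : 6 ≤ k) :
    j ∈ copyEdge k s [] (k - 1) ↔ j = 0 ∨ j = k ∨ 1 ≤ j ∧ j ≤ k - 4 := by
  have h : k - 1 = k - 2 + 1 := by omega
  have h' : k - 2 + 2 = k := by omega
  simp [copyEdge, starEdge, h, h', Nat.sub_sub]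

theorem mem_copyLastTwo :
    j ∈ copyLastTwo k s p ↔ j = 2 * copySize k s p - 2 ∨ j = 2 * copySize k s p - 1 := by
  unfold copyLastTwo copySize
  split_ifs <;> simp

theorem mem_copyVerts_nil (hk : 6 ≤ k) : j ∈ copyVerts k s [] ↔ j ≤ 2 * (k - 2) - 1 := by
  simp [copyVerts, starVerts, blockVerts]; omega

theorem mem_copyVerts_of_ne_nil (hp : p ≠ []) :
    j ∈ copyVerts k s p ↔ 1 ≤ j ∧ j ≤ 2 * copySize k s p - 1 := by
  unfold copyVerts copySize blockVerts
  split_ifs <;> simp_all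

theorem IsEdgeIndex.le_copySize_or (hk : 6 ≤ k) (h : IsEdgeIndex k s p i) :
    i ≤ copySize k s p ∨ p = [] ∧ i = k - 1 := by
  obtain ⟨-, -, h⟩ := h
  by_cases hp : p = []
  · subst hp
    rw [copyNumEdges_nil] at h
    rw [copySize_nil]
    simp only [true_and]
    omega
  · exact .inl (copyNumEdges_of_ne_nil hp ▸ h)

theorem IsEdgeIndex.of_le_copySize (hp : IsCopy k s p) (hi : 1 ≤ i) (him : i ≤ copySize k s p) :
    IsEdgeIndex k s p i :=
  ⟨hp, hi, him.trans copySize_le_copyNumEdges⟩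

theorem isEdgeIndex_star (hk : 6 ≤ k) : IsEdgeIndex k s [] (k - 1) :=
  ⟨.nil, by omega, by rw [copyNumEdges_nil]⟩

theorem IsCopy.isEdgeIndex (h : IsCopy k s (i :: p)) : IsEdgeIndex k s p i := by
  cases h with
  | cons _ _ hp _ hi hi' => exact ⟨hp, hi, hi'⟩

theorem IsCopy.length_le_of_cons (h : IsCopy k s (i :: p)) : p.length ≤ s := by
  cases h with
  | cons _ _ _ hl _ _ => exact hl

theorem IsEdgeIndex.isCopy_cons (h : IsEdgeIndex k s p i) (hl : p.length ≠ s + 1) :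
    IsCopy k s (i :: p) :=
  .cons i p h.1 (by have := h.1.length_le; omega) h.2.1 h.2.2

theorem IsCopy.of_append {r : List ℕ} (h : IsCopy k s (r ++ p)) : IsCopy k s p := by
  induction r with
  | nil => exact h
  | cons a r ih => exact ih h.isEdgeIndex.1

theorem mem_layeredEdge :
    (q, j) ∈ layeredEdge k s p i ↔ q = p ∧ j ∈ copyEdge k s p i ∨
      p.length ≠ s + 1 ∧ q = i :: p ∧ j ∈ copyLastTwo k s (i :: p) := by
  unfold layeredEdge
  by_cases h : p.length = s + 1 <;> simp [h] <;> tauto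

theorem mem_layeredEdge_self : (p, j) ∈ layeredEdge k s p i ↔ j ∈ copyEdge k s p i := by
  simp [mem_layeredEdge]

theorem mem_vertexSet_layered (hk : 6 ≤ k) :
    (p, j) ∈ V(layered k s hk) ↔ IsCopy k s p ∧ j ∈ copyVerts k s p := Iff.rfl

theorem mem_edgeSet_layered (hk : 6 ≤ k) {e : Set (List ℕ × ℕ)} :
    e ∈ E(layered k s hk) ↔ ∃ p i, IsEdgeIndex k s p i ∧ e = layeredEdge k s p i := by
  simp [layered, IsEdgeIndex, and_assoc]

theorem IsEdgeIndex.mem_edgeSet (hk : 6 ≤ k) (h : IsEdgeIndex k s p i) :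
    layeredEdge k s p i ∈ E(layered k s hk) :=
  (mem_edgeSet_layered hk).2 ⟨p, i, h, rfl⟩

/-- Every vertex lies in an edge of its own copy. -/
theorem exists_mem_copyEdge (hk : 6 ≤ k) (h : (p, j) ∈ V(layered k s hk)) :
    ∃ i, IsEdgeIndex k s p i ∧ j ∈ copyEdge k s p i := by
  rw [mem_vertexSet_layered] at h
  obtain ⟨hp, hj⟩ := h
  have h4 := four_le_copySize (s := s) (p := p) hk
  by_cases h0 : p = [] ∧ j = 0
  · obtain ⟨rfl, rfl⟩ := h0
    exact ⟨k - 1, isEdgeIndex_star hk, (mem_copyEdge_star hk).2 (.inl rfl)⟩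
  have hj' : 1 ≤ j ∧ j ≤ 2 * copySize k s p - 1 := by
    by_cases hp' : p = []
    · subst hp'
      rw [mem_copyVerts_nil hk] at hj
      rw [copySize_nil]
      simp only [true_and] at h0
      omega
    · exact (mem_copyVerts_of_ne_nil hp').1 hj
  by_cases hjm : j ≤ copySize k s p
  · exact ⟨j, .of_le_copySize hp hj'.1 hjm, (mem_copyEdge hj'.1 hjm).2 (by omega)⟩
  · exact ⟨copySize k s p, .of_le_copySize hp (by omega) le_rfl,
      (mem_copyEdge (by omega) le_rfl).2 (by omega)⟩

end Copies

/-! ### Criteria for involutions -/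

/-- An involutive map that respects the vertices and the edges is an involution. -/
theorem hasInvolution_of_involutive {α : Type*} {H : Hypergraph α} {f : α → α}
    (hf : Function.Involutive f) (hV : ∀ x ∈ V(H), f x ∈ V(H))
    (hE : ∀ e ∈ E(H), f '' e ∈ E(H)) {x : α} (hx : x ∈ V(H)) (hfx : f x ≠ x) :
    H.HasInvolution := by
  let g : V(H) → V(H) := fun v => ⟨f v, hV v v.2⟩
  have hg : Function.Involutive g := fun v => Subtype.ext (hf v)
  have himg : ∀ e : Set V(H), Subtype.val '' (g '' e) = f '' (Subtype.val '' e) := fun e => by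
    rw [← Set.image_comp, ← Set.image_comp]; rfl
  refine ⟨hg.toPerm, fun e => ?_, fun h => hfx ?_, hg⟩
  · change _ ↔ Subtype.val '' (g '' e) ∈ E(H)
    rw [himg]
    refine ⟨hE _, fun h => ?_⟩
    have := hE _ h
    rwa [← Set.image_comp, hf.comp_self, Set.image_id] at this
  · exact congrArg Subtype.val (DFunLike.congr_fun h ⟨x, hx⟩)

/-- Two vertices that lie in the same edges can be interchanged. -/
theorem hasInvolution_of_twins {α : Type*} {H : Hypergraph α} {x y : α} (hxy : x ≠ y)
    (hx : x ∈ V(H)) (hy : y ∈ V(H)) (h : ∀ e ∈ E(H), x ∈ e ↔ y ∈ e) : H.HasInvolution := by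
  classical
  refine hasInvolution_of_involutive (f := Equiv.swap x y) (fun z => by simp)
    (fun z hz => ?_) (fun e he => ?_) hx (by simpa using hxy.symm)
  · rw [Equiv.swap_apply_def]; split_ifs <;> assumption
  · suffices Equiv.swap x y '' e = e by rwa [this]
    ext z
    rw [Equiv.image_eq_preimage_symm, Equiv.symm_swap, Set.mem_preimage, Equiv.swap_apply_def]
    split_ifs with h1 h2
    · rw [h1, h e he]
    · rw [h2, h e he]
    · rfl

/-! ### Permuting the children of a copy -/

/-- Move the descendants of the `i`-th child of the copy `p` to the `σ i`-th child of `p`. -/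
def permuteChildren (p : List ℕ) (σ : ℕ → ℕ) : List ℕ → List ℕ
  | [] => []
  | a :: t => if t = p then σ a :: t else a :: permuteChildren p σ t

section PermuteChildren

variable {p : List ℕ} {σ : ℕ → ℕ}

theorem permuteChildren_length (t : List ℕ) :
    (permuteChildren p σ t).length = t.length := by
  induction t with
  | nil => rfl
  | cons a t ih => unfold permuteChildren; split_ifs <;> simp [ih]

theorem permuteChildren_of_length_le {t : List ℕ} (h : t.length ≤ p.length) :
    permuteChildren p σ t = t := by
  induction t with
  | nil => rfl
  | cons a t ih =>
    have ht : t ≠ p := by rintro rfl; simp at h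
    simp only [List.length_cons] at h
    simp [permuteChildren, ht, ih (by omega)]

theorem permuteChildren_self : permuteChildren p σ p = p := permuteChildren_of_length_le le_rfl

theorem permuteChildren_involutive (hσ : Function.Involutive σ) :
    Function.Involutive (permuteChildren p σ) := by
  intro t
  induction t with
  | nil => rfl
  | cons a t ih =>
    by_cases h : t = p
    · simp [permuteChildren, h, hσ a]
    · have h' : permuteChildren p σ t ≠ p := fun h' => h <| by
        rw [← ih, h', permuteChildren_self]
      simp [permuteChildren, h, h', ih]

theorem permuteChildren_cons_self (a : ℕ) : permuteChildren p σ (a :: p) = σ a :: p := by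
  simp [permuteChildren]

theorem permuteChildren_append (r : List ℕ) (a : ℕ) :
    permuteChildren p σ (r ++ a :: p) = r ++ σ a :: p := by
  induction r with
  | nil => exact permuteChildren_cons_self a
  | cons b r ih =>
    have h : r ++ a :: p ≠ p := fun h => by
      have := congrArg List.length h
      simp only [List.length_append, List.length_cons] at this
      omega
    simp [permuteChildren, h, ih]

theorem permuteChildren_eq_self_or (t : List ℕ) :
    permuteChildren p σ t = t ∨ ∃ r a, t = r ++ a :: p := by
  induction t with
  | nil => exact .inl rfl
  | cons b t ih =>
    by_cases h : t = p
    · exact .inr ⟨[], b, by simp [h]⟩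
    · rcases ih with ih | ⟨r, a, rfl⟩
      · exact .inl (by simp [permuteChildren, h, ih])
      · exact .inr ⟨b :: r, a, rfl⟩

end PermuteChildren

/-- `permuteChildren` on the descendants of `p`, and `τ` on the vertices of the copy `p`. -/
def blockMap (p : List ℕ) (σ τ : ℕ → ℕ) (x : List ℕ × ℕ) : List ℕ × ℕ :=
  (permuteChildren p σ x.1, if x.1 = p then τ x.2 else x.2)

section BlockMap

variable {p : List ℕ} {σ τ : ℕ → ℕ}

theorem blockMap_involutive (hσ : Function.Involutive σ) (hτ : Function.Involutive τ) :
    Function.Involutive (blockMap p σ τ) := by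
  rintro ⟨t, j⟩
  have hinv := permuteChildren_involutive (p := p) hσ t
  by_cases h : t = p
  · subst h
    simp [blockMap, permuteChildren_self, hτ j]
  · have h' : permuteChildren p σ t ≠ p := fun h' => h <| by
      rw [← hinv, h', permuteChildren_self]
    simp [blockMap, h, h', hinv]

/-- The hypothesis `i :: t ≠ p` excludes the edge to which `p` is attached: `τ` need not preserve
the last two vertices of `p`. -/
theorem blockMap_image_layeredEdge {k s i i' : ℕ} {t : List ℕ}
    (hσ : Function.Involutive σ) (hτ : Function.Involutive τ)
    (hE : t = p → ∀ j, j ∈ copyEdge k s p i ↔ τ j ∈ copyEdge k s p (σ i))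
    (hi : i' = if t = p then σ i else i) (hup : i :: t ≠ p) :
    blockMap p σ τ '' layeredEdge k s t i = layeredEdge k s (permuteChildren p σ t) i' := by
  have hinv := blockMap_involutive (p := p) hσ hτ
  have hcons : permuteChildren p σ (i :: t) = i' :: permuteChildren p σ t := by
    by_cases h : t = p
    · subst h; simp [hi, permuteChildren_cons_self, permuteChildren_self]
    · simp [hi, h, permuteChildren]
  have hiff : ∀ x, x ∈ layeredEdge k s t i ↔
      blockMap p σ τ x ∈ layeredEdge k s (permuteChildren p σ t) i' := by
    rintro ⟨q, j⟩
    have hinj := (permuteChildren_involutive (p := p) hσ).injective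
    simp only [blockMap, mem_layeredEdge, ← hcons, hinj.eq_iff, permuteChildren_length]
    refine or_congr (and_congr_right ?_) (and_congr_right fun _ => and_congr_right ?_)
    · rintro rfl
      by_cases h : q = p
      · subst h; simpa [hi, permuteChildren_self] using hE rfl j
      · rw [if_neg h, hi, if_neg h, copyEdge_congr (permuteChildren_length q)]
    · rintro rfl
      rw [if_neg hup, copyLastTwo_congr (permuteChildren_length _)]
  ext x
  constructor
  · rintro ⟨y, hy, rfl⟩
    exact (hiff y).1 hy
  · intro hx
    exact ⟨blockMap p σ τ x, (hiff _).2 (by rwa [hinv x]), hinv x⟩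

end BlockMap

/-! ### Subhypergraphs without an involution -/

/-- The edge number `i` of the copy `p` of `G_{k,s}` belongs to `H`. -/
def HasEdge (H : Hypergraph (List ℕ × ℕ)) (k s : ℕ) (p : List ℕ) (i : ℕ) : Prop :=
  IsEdgeIndex k s p i ∧ layeredEdge k s p i ∈ E(H)

/-- All edges of the copy `i :: p` and of the copies below it behave as the edge of the copy `p`
to which `i :: p` is attached: they belong to `H` or they do not. -/
def IsUniformBelow (H : Hypergraph (List ℕ × ℕ)) (k s : ℕ) (p : List ℕ) (i : ℕ) : Prop :=
  ∀ r a, IsEdgeIndex k s (r ++ i :: p) a → (HasEdge H k s (r ++ i :: p) a ↔ HasEdge H k s p i)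

section Sub

variable {k s : ℕ} {H : Hypergraph (List ℕ × ℕ)} {p : List ℕ} {i j : ℕ}

theorem IsSubhypergraph.exists_hasEdge {hk : 6 ≤ k} (hH : H.IsSubhypergraph (layered k s hk))
    {e : Set (List ℕ × ℕ)} (he : e ∈ E(H)) : ∃ p i, HasEdge H k s p i ∧ e = layeredEdge k s p i := by
  obtain ⟨p, i, hpi, rfl⟩ := (mem_edgeSet_layered hk).1 (hH.2 he)
  exact ⟨p, i, ⟨hpi, he⟩, rfl⟩

theorem HasEdge.mem_vertexSet (h : HasEdge H k s p i) (hj : j ∈ copyEdge k s p i) :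
    (p, j) ∈ V(H) :=
  mem_vertexSet_of_mem_edgeSet h.2 (mem_layeredEdge_self.2 hj)

theorem HasEdge.mem_vertexSet_child (h : HasEdge H k s p i) (hl : p.length ≠ s + 1)
    (hj : j ∈ copyLastTwo k s (i :: p)) : (i :: p, j) ∈ V(H) :=
  mem_vertexSet_of_mem_edgeSet h.2 (mem_layeredEdge.2 (.inr ⟨hl, rfl, hj⟩))

theorem isCopy_append_congr {r : List ℕ} {a b : ℕ} (h : IsCopy k s (r ++ a :: p))
    (hb : IsEdgeIndex k s p b) : IsCopy k s (r ++ b :: p) := by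
  induction r with
  | nil => exact .cons b p hb.1 h.length_le_of_cons hb.2.1 hb.2.2
  | cons c r ih =>
    have hc := h.isEdgeIndex
    have hlen : (r ++ a :: p).length = (r ++ b :: p).length := by simp
    exact .cons c _ (ih hc.1) (hlen ▸ h.length_le_of_cons) hc.2.1
      (copyNumEdges_congr hlen ▸ hc.2.2)

theorem isEdgeIndex_append_congr {r : List ℕ} {a b : ℕ} (h : IsEdgeIndex k s (r ++ a :: p) i)
    (hb : IsEdgeIndex k s p b) : IsEdgeIndex k s (r ++ b :: p) i :=
  ⟨isCopy_append_congr h.1 hb, h.2.1,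
    copyNumEdges_congr (k := k) (s := s) (p := r ++ a :: p) (q := r ++ b :: p) (by simp) ▸ h.2.2⟩

/-- A symmetry of one copy drags whole subtrees along. Subtrees under present edges are complete and
thus interchangeable. Under an absent edge there may still be an arbitrary set of isolated vertices,
so `hσH` makes `σ` fix such an edge number. -/
theorem hasInvolution_of_blockMap {σ τ : ℕ → ℕ} {hk : 6 ≤ k}
    (hH : H.IsSubhypergraph (layered k s hk))
    (hσ : Function.Involutive σ) (hτ : Function.Involutive τ)
    (hbelow : ∀ a, IsUniformBelow H k s p a)
    (hE : ∀ i, HasEdge H k s p i →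
      HasEdge H k s p (σ i) ∧ ∀ j, j ∈ copyEdge k s p i ↔ τ j ∈ copyEdge k s p (σ i))
    (hσH : ∀ a, IsEdgeIndex k s p a → σ a = a ∨ HasEdge H k s p a)
    (hτH : ∀ j, (p, j) ∈ V(H) → (p, τ j) ∈ V(H))
    (hne : ∃ j, (p, j) ∈ V(H) ∧ τ j ≠ j)
    (hup : ∀ t i, HasEdge H k s t i → i :: t ≠ p) : H.HasInvolution := by
  obtain ⟨j₀, hj₀, hτj₀⟩ := hne
  refine hasInvolution_of_involutive (blockMap_involutive (p := p) hσ hτ) ?_ ?_ hj₀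
    (fun h => hτj₀ (by simpa [blockMap] using congrArg Prod.snd h))
  · rintro ⟨t, j⟩ hx
    by_cases htp : t = p
    · subst htp
      simpa [blockMap, permuteChildren_self] using hτH j hx
    rcases permuteChildren_eq_self_or (p := p) (σ := σ) t with ht | ⟨r, a, rfl⟩
    · simpa [blockMap, htp, ht] using hx
    · obtain ⟨i, hi, hj⟩ := exists_mem_copyEdge hk (hH.1 hx)
      have ha : IsEdgeIndex k s p a := hi.1.of_append.isEdgeIndex
      rcases hσH a ha with h | h
      · simpa [blockMap, htp, permuteChildren_append, h] using hx
      · have hσa := (hE a h).1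
        have := (hbelow (σ a) r i (isEdgeIndex_append_congr hi hσa.1)).2 hσa
        simp only [blockMap, htp, if_false, permuteChildren_append]
        exact this.mem_vertexSet (copyEdge_congr (k := k) (s := s) (p := r ++ a :: p)
          (q := r ++ σ a :: p) (by simp) ▸ hj)
  · intro e he
    obtain ⟨t, i, hi, rfl⟩ := hH.exists_hasEdge he
    rw [blockMap_image_layeredEdge hσ hτ (fun h => (hE i (by rwa [← h])).2) rfl (hup t i hi)]
    by_cases htp : t = p
    · subst htp
      simpa [permuteChildren_self] using (hE i hi).1.2
    rw [if_neg htp]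
    rcases permuteChildren_eq_self_or (p := p) (σ := σ) t with ht | ⟨r, a, rfl⟩
    · rw [ht]; exact hi.2
    · rw [permuteChildren_append]
      have hσa := (hE a ((hbelow a r i hi.1).1 hi)).1
      exact ((hbelow (σ a) r i (isEdgeIndex_append_congr hi.1 hσa.1)).2 hσa).2

/-- A criterion for two vertices of the same copy to be interchangeable. -/
theorem hasInvolution_of_copy_twins {hk : 6 ≤ k} (hH : H.IsSubhypergraph (layered k s hk))
    {j j' : ℕ} (hjj' : j ≠ j') (hj : (p, j) ∈ V(H)) (hj' : (p, j') ∈ V(H))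
    (hown : ∀ i, HasEdge H k s p i → (j ∈ copyEdge k s p i ↔ j' ∈ copyEdge k s p i))
    (hup : p ≠ [] → (j ∈ copyLastTwo k s p ↔ j' ∈ copyLastTwo k s p)) : H.HasInvolution := by
  refine hasInvolution_of_twins (x := (p, j)) (y := (p, j')) (by simpa using hjj') hj hj' ?_
  intro e he
  obtain ⟨t, i, hi, rfl⟩ := hH.exists_hasEdge he
  simp only [mem_layeredEdge]
  refine or_congr (and_congr_right ?_) (and_congr_right fun _ => and_congr_right ?_)
  · rintro rfl; exact hown i hi
  · rintro rfl; exact hup (by simp)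

/-- The reversal of `{1, …, n}`. -/
def reflect (n j : ℕ) : ℕ := if 1 ≤ j ∧ j ≤ n then n + 1 - j else j

theorem reflect_involutive (n : ℕ) : Function.Involutive (reflect n) := by
  intro j; unfold reflect; split_ifs <;> omega

theorem mem_copyEdge_reflect (hi : 1 ≤ i) (him : i ≤ copySize k s p) :
    j ∈ copyEdge k s p i ↔
      reflect (2 * copySize k s p - 1) j ∈ copyEdge k s p (reflect (copySize k s p) i) := by
  have h : reflect (copySize k s p) i = copySize k s p + 1 - i := by simp [reflect, hi, him]
  rw [h, mem_copyEdge hi him, mem_copyEdge (by omega) (by omega)]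
  unfold reflect
  split_ifs <;> omega

/-- In a copy that is not on the top layer, either no edge is missing or all are. -/
theorem hasEdge_of_hasEdge {hk : 6 ≤ k} (hH : H.IsSubhypergraph (layered k s hk))
    (hinv : ¬ H.HasInvolution) (hp : p ≠ []) {i i' : ℕ} (h : HasEdge H k s p i)
    (hi' : IsEdgeIndex k s p i') : HasEdge H k s p i' := by
  have h4 := four_le_copySize (s := s) (p := p) hk
  have hle : ∀ i, IsEdgeIndex k s p i → 1 ≤ i ∧ i ≤ copySize k s p := fun i hi =>
    ⟨hi.2.1, (hi.le_copySize_or hk).resolve_right fun h => hp h.1⟩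
  have hmem : ∀ i, HasEdge H k s p i → ∀ j,
      (j ∈ copyEdge k s p i ↔ i ≤ j ∧ j < i + copySize k s p) :=
    fun i hi j => mem_copyEdge (hle i hi.1).1 (hle i hi.1).2
  have h1 : HasEdge H k s p 1 := by
    by_contra h1
    have hne : ∀ i, HasEdge H k s p i → 2 ≤ i ∧ i ≤ copySize k s p := fun i hi => by
      have := hle i hi.1
      have : i ≠ 1 := by rintro rfl; exact h1 hi
      omega
    -- Among the `M_i` only `M_1` separates `v_m` from `v_{m+1}`; since `m ≥ 4`, neither is one of
    -- the last two vertices.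
    refine hinv (hasInvolution_of_copy_twins hH (p := p) (j := copySize k s p)
      (j' := copySize k s p + 1) (by omega) (h.mem_vertexSet ?_) (h.mem_vertexSet ?_)
      (fun i hi => ?_) (fun _ => ?_))
    · rw [hmem i h]; have := hne i h; omega
    · rw [hmem i h]; have := hne i h; omega
    · rw [hmem i hi, hmem i hi]; have := hne i hi; omega
    · rw [mem_copyLastTwo, mem_copyLastTwo]; omega
  by_contra hn
  have hi'1 : i' ≠ 1 := by rintro rfl; exact hn h1
  have hi'm := hle i' hi'
  -- Only `M_{i'}` separates `v_{i'-1}` from `v_{i'}`; both lie in `M_1`, so they are vertices of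
  -- `H`.
  refine hinv (hasInvolution_of_copy_twins hH (p := p) (j := i' - 1)
      (j' := i') (by omega) (h1.mem_vertexSet ?_) (h1.mem_vertexSet ?_)
      (fun i hi => ?_) (fun _ => ?_))
  · rw [hmem 1 h1]; omega
  · rw [hmem 1 h1]; omega
  · rw [hmem i hi, hmem i hi]
    have := hle i hi.1
    have : i ≠ i' := by rintro rfl; exact hn hi
    omega
  · rw [mem_copyLastTwo, mem_copyLastTwo]; omega

/-- The edge to which a copy is attached belongs to `H` if and only if those of the copy do. -/
theorem hasEdge_child_iff {hk : 6 ≤ k} (hH : H.IsSubhypergraph (layered k s hk))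
    (hinv : ¬ H.HasInvolution) {c : ℕ} (hbelow : ∀ a, IsUniformBelow H k s (c :: p) a)
    (hi : IsEdgeIndex k s (c :: p) i) : HasEdge H k s (c :: p) i ↔ HasEdge H k s p c := by
  have h4 := four_le_copySize (s := s) (p := c :: p) hk
  have hle : ∀ i, IsEdgeIndex k s (c :: p) i → 1 ≤ i ∧ i ≤ copySize k s (c :: p) := fun i hi =>
    ⟨hi.2.1, (hi.le_copySize_or hk).resolve_right (by simp)⟩
  constructor
  · intro h
    have hall : ∀ i, IsEdgeIndex k s (c :: p) i → HasEdge H k s (c :: p) i := fun i hi =>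
      hasEdge_of_hasEdge hH hinv (by simp) h hi
    by_contra hup
    have hrefl : ∀ i, IsEdgeIndex k s (c :: p) i →
        HasEdge H k s (c :: p) (reflect (copySize k s (c :: p)) i) := fun i hi => by
      have := hle i hi
      refine hall _ (.of_le_copySize hi.1 ?_ ?_) <;> unfold reflect <;> split_ifs <;> omega
    -- Without the edge above, nothing distinguishes the two ends of the complete copy `c :: p`, so
    -- it can be reversed.
    refine hinv (hasInvolution_of_blockMap hH (reflect_involutive (copySize k s (c :: p)))
      (reflect_involutive (2 * copySize k s (c :: p) - 1)) hbelow (fun i hi => ?_)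
      (fun a ha => .inr (hall a ha)) (fun j hj => ?_) ⟨1, ?_, ?_⟩ ?_)
    · exact ⟨hrefl i hi.1, fun j => mem_copyEdge_reflect (hle i hi.1).1 (hle i hi.1).2⟩
    · obtain ⟨i, hi, hj⟩ := exists_mem_copyEdge hk (hH.1 hj)
      exact (hrefl i hi).mem_vertexSet ((mem_copyEdge_reflect (hle i hi).1 (hle i hi).2).1 hj)
    · have := hall 1 (.of_le_copySize hi.1 le_rfl (by omega))
      exact this.mem_vertexSet ((mem_copyEdge le_rfl (by omega)).2 (by omega))
    · unfold reflect; split_ifs <;> omega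
    · rintro t i' hi' heq
      obtain ⟨rfl, rfl⟩ := List.cons_eq_cons.1 heq
      exact hup hi'
  · intro hup
    by_contra hn
    have hl : p.length ≠ s + 1 := by have := hi.1.length_le_of_cons; omega
    -- With no edge of its own, the copy has its last two vertices only in the edge it is attached
    -- to.
    refine hinv (hasInvolution_of_copy_twins hH (p := c :: p)
      (j := 2 * copySize k s (c :: p) - 2) (j' := 2 * copySize k s (c :: p) - 1) (by omega)
      (hup.mem_vertexSet_child hl (mem_copyLastTwo.2 (.inl rfl)))
      (hup.mem_vertexSet_child hl (mem_copyLastTwo.2 (.inr rfl)))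
      (fun i' hi' => (hn (hasEdge_of_hasEdge hH hinv (by simp) hi' hi)).elim) (fun _ => ?_))
    simp [mem_copyLastTwo]

theorem isUniformBelow {hk : 6 ≤ k} (hH : H.IsSubhypergraph (layered k s hk))
    (hinv : ¬ H.HasInvolution) (p : List ℕ) (c : ℕ) : IsUniformBelow H k s p c := by
  -- Induction from layer 1 upwards: reversing `c :: p` requires uniformity below all of its edges.
  induction hn : s + 1 - p.length generalizing p c with
  | zero =>
    intro r a h
    have := h.1.length_le
    simp only [List.length_append, List.length_cons] at this
    omega
  | succ n ih =>
    intro r a h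
    have hbelow : ∀ b, IsUniformBelow H k s (c :: p) b := fun b => ih (c :: p) b (by
      simp only [List.length_cons]; omega)
    rcases r.eq_nil_or_concat with rfl | ⟨r, b, rfl⟩
    · exact hasEdge_child_iff hH hinv hbelow h
    · simp only [List.concat_eq_append, List.append_assoc, List.cons_append, List.nil_append]
        at h ⊢
      rw [hbelow b r a h, hasEdge_child_iff hH hinv hbelow h.1.of_append.isEdgeIndex]

end Sub

/-! ### The top copy, of `G*_{k-2}` -/

section Star

variable {k s : ℕ} {H : Hypergraph (List ℕ × ℕ)} {i j : ℕ}

theorem isEdgeIndex_nil : IsEdgeIndex k s [] i ↔ 1 ≤ i ∧ i ≤ k - 1 := by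
  simp [IsEdgeIndex, copyNumEdges_nil, IsCopy.nil]

theorem mem_copyEdge_nil (hi : 1 ≤ i) (him : i ≤ k - 2) :
    j ∈ copyEdge k s [] i ↔ i ≤ j ∧ j < i + (k - 2) := by
  rw [mem_copyEdge hi (by rwa [copySize_nil]), copySize_nil]

theorem isUniformBelow_iff_nil {hk : 6 ≤ k} (hH : H.IsSubhypergraph (layered k s hk))
    (hinv : ¬ H.HasInvolution) {t : List ℕ} (h : IsEdgeIndex k s t i) :
    ∃ c, IsEdgeIndex k s [] c ∧ (HasEdge H k s t i ↔ HasEdge H k s [] c) := by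
  rcases t.eq_nil_or_concat with rfl | ⟨r, c, rfl⟩
  · exact ⟨i, h, Iff.rfl⟩
  · rw [List.concat_eq_append] at h ⊢
    exact ⟨c, h.1.of_append.isEdgeIndex, isUniformBelow hH hinv [] c r i h⟩

/-- A subhypergraph without an involution that has all edges of the top copy is everything. -/
theorem eq_layered_of_hasEdge_nil {hk : 6 ≤ k} (hH : H.IsSubhypergraph (layered k s hk))
    (hinv : ¬ H.HasInvolution) (h : ∀ i, IsEdgeIndex k s [] i → HasEdge H k s [] i) :
    H = layered k s hk := by
  have hall : ∀ t i, IsEdgeIndex k s t i → HasEdge H k s t i := fun t i hti => by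
    obtain ⟨c, hc, hiff⟩ := isUniformBelow_iff_nil hH hinv hti
    exact hiff.2 (h c hc)
  refine Hypergraph.ext (hH.1.antisymm ?_) (hH.2.antisymm ?_)
  · rintro ⟨t, j⟩ hj
    obtain ⟨i, hi, hji⟩ := exists_mem_copyEdge hk hj
    exact (hall t i hi).mem_vertexSet hji
  · intro e he
    obtain ⟨t, i, hi, rfl⟩ := (mem_edgeSet_layered hk).1 he
    exact (hall t i hi).2

theorem exists_hasEdge_nil {hk : 6 ≤ k} (hH : H.IsSubhypergraph (layered k s hk))
    (hinv : ¬ H.HasInvolution) (h2 : 2 ≤ V(H).ncard) : ∃ i, HasEdge H k s [] i := by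
  by_contra! hno
  obtain ⟨x, y, hx, hy, hxy⟩ :=
    (Set.one_lt_ncard_iff (Set.finite_of_ncard_pos (by omega))).1 h2
  refine hinv (hasInvolution_of_twins hxy hx hy fun e he => ?_)
  obtain ⟨t, i, hi, rfl⟩ := hH.exists_hasEdge he
  obtain ⟨c, -, hiff⟩ := isUniformBelow_iff_nil hH hinv hi.1
  exact (hno c (hiff.1 hi)).elim

/-- The involution of the edge numbers of `G*_4` without `M_3`. -/
def starSwapEdges (i : ℕ) : ℕ :=
  if i = 1 then 2 else if i = 2 then 1 else if i = 4 then 5 else if i = 5 then 4 else i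

/-- The involution of the vertices of `G*_4` without the edge `M_3`. -/
def starSwapVerts (j : ℕ) : ℕ :=
  if j = 0 then 7 else if j = 7 then 0 else if j = 1 then 5 else if j = 5 then 1
  else if j = 2 then 4 else if j = 4 then 2 else j

theorem starSwapEdges_involutive : Function.Involutive starSwapEdges := by
  intro i; unfold starSwapEdges; grind

theorem starSwapVerts_involutive : Function.Involutive starSwapVerts := by
  intro j; unfold starSwapVerts; grind

/-- For `k = 6` the remaining edges `1234`, `2345`, `4567` and `x126` have a symmetry exchanging the
first two and the last two. The absence of an involution is assumed only to get uniformity below the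
top copy; the conclusion then refutes it. -/
theorem hasInvolution_of_starSwap {hk : 6 ≤ 6} (hH : H.IsSubhypergraph (layered 6 s hk))
    (hinv : ¬ H.HasInvolution) (h1 : HasEdge H 6 s [] 1) (h2 : HasEdge H 6 s [] 2)
    (h3 : ¬ HasEdge H 6 s [] 3) (h4 : HasEdge H 6 s [] 4) (h5 : HasEdge H 6 s [] 5) :
    H.HasInvolution := by
  have m1 : ∀ j, j ∈ copyEdge 6 s [] 1 ↔ 1 ≤ j ∧ j < 5 := fun j =>
    mem_copyEdge_nil (by omega) (by omega)
  have m2 : ∀ j, j ∈ copyEdge 6 s [] 2 ↔ 2 ≤ j ∧ j < 6 := fun j =>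
    mem_copyEdge_nil (by omega) (by omega)
  have m4 : ∀ j, j ∈ copyEdge 6 s [] 4 ↔ 4 ≤ j ∧ j < 8 := fun j =>
    mem_copyEdge_nil (by omega) (by omega)
  have m5 : ∀ j, j ∈ copyEdge 6 s [] 5 ↔ j = 0 ∨ j = 6 ∨ 1 ≤ j ∧ j ≤ 2 := fun j =>
    mem_copyEdge_star hk
  have hcases : ∀ i, IsEdgeIndex 6 s [] i → i = 1 ∨ i = 2 ∨ i = 3 ∨ i = 4 ∨ i = 5 := fun i hi => by
    have := isEdgeIndex_nil.1 hi
    omega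
  have hV : ∀ j, j < 8 → ([], j) ∈ V(H) := fun j hj => by
    by_cases hj0 : j = 0
    · exact h5.mem_vertexSet ((m5 j).2 (by omega))
    by_cases hj4 : j ≤ 4
    · exact h1.mem_vertexSet ((m1 j).2 (by omega))
    · exact h4.mem_vertexSet ((m4 j).2 (by omega))
  refine hasInvolution_of_blockMap hH starSwapEdges_involutive starSwapVerts_involutive
    (isUniformBelow hH hinv []) (fun i hi => ?_) (fun i hi => ?_) (fun j hj => ?_)
    ⟨0, hV 0 (by omega), by simp [starSwapVerts]⟩ (by simp)
  · rcases hcases i hi.1 with rfl | rfl | rfl | rfl | rfl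
    · refine ⟨h2, fun j => (m1 j).trans (Iff.trans ?_ (m2 _).symm)⟩
      unfold starSwapVerts; grind
    · refine ⟨h1, fun j => (m2 j).trans (Iff.trans ?_ (m1 _).symm)⟩
      unfold starSwapVerts; grind
    · exact (h3 hi).elim
    · refine ⟨h5, fun j => (m4 j).trans (Iff.trans ?_ (m5 _).symm)⟩
      unfold starSwapVerts; grind
    · refine ⟨h4, fun j => (m5 j).trans (Iff.trans ?_ (m4 _).symm)⟩
      unfold starSwapVerts; grind
  · rcases hcases i hi with rfl | rfl | rfl | rfl | rfl
    exacts [.inr h1, .inr h2, .inl rfl, .inr h4, .inr h5]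
  · have := (mem_copyVerts_nil hk).1 ((mem_vertexSet_layered hk).1 (hH.1 hj)).2
    refine hV _ ?_
    unfold starSwapVerts; split_ifs <;> omega

/-- Every proper subhypergraph of `G_{k,s}` with at least two vertices has an involution. -/
theorem hasInvolution_of_ne_layered {hk : 6 ≤ k} (hH : H.IsSubhypergraph (layered k s hk))
    (hne : H ≠ layered k s hk) (h2 : 2 ≤ V(H).ncard) : H.HasInvolution := by
  by_contra hinv
  have hidx : ∀ i, HasEdge H k s [] i → 1 ≤ i ∧ i ≤ k - 2 ∨ i = k - 1 := fun i hi => by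
    have := isEdgeIndex_nil.1 hi.1
    omega
  have hstar : ∀ j, j ∈ copyEdge k s [] (k - 1) ↔ j = 0 ∨ j = k ∨ 1 ≤ j ∧ j ≤ k - 4 :=
    fun j => mem_copyEdge_star hk
  have htwins : ∀ j j', j ≠ j' → ([], j) ∈ V(H) → ([], j') ∈ V(H) →
      ¬ ((∀ i, 1 ≤ i → i ≤ k - 2 → HasEdge H k s [] i →
        (i ≤ j ∧ j < i + (k - 2) ↔ i ≤ j' ∧ j' < i + (k - 2))) ∧
      (HasEdge H k s [] (k - 1) →
        (j = 0 ∨ j = k ∨ 1 ≤ j ∧ j ≤ k - 4 ↔ j' = 0 ∨ j' = k ∨ 1 ≤ j' ∧ j' ≤ k - 4))) := by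
    rintro j j' hjj' hj hj' ⟨hE, hS⟩
    refine hinv (hasInvolution_of_copy_twins hH hjj' hj hj' (fun i hi => ?_) (by simp))
    rcases hidx i hi with ⟨hi1, him⟩ | rfl
    · rw [mem_copyEdge_nil hi1 him, mem_copyEdge_nil hi1 him]
      exact hE i hi1 him hi
    · rw [hstar, hstar]
      exact hS hi
  have h1 : HasEdge H k s [] 1 := by
    by_contra h1
    by_cases hex : ∃ i, i ≤ k - 2 ∧ HasEdge H k s [] i
    · obtain ⟨i, him, hi⟩ := hex
      have hi1 : 2 ≤ i := by
        have := hi.1.2.1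
        have : i ≠ 1 := by rintro rfl; exact h1 hi
        omega
      -- These are `v_m` and `v_{m+1}` with `m = k - 2`; neither lies in `M*`.
      refine htwins (k - 2) (k - 1) (by omega)
        (hi.mem_vertexSet ((mem_copyEdge_nil (by omega) him).2 (by omega)))
        (hi.mem_vertexSet ((mem_copyEdge_nil (by omega) him).2 (by omega)))
        ⟨fun i' hi'1 hi'm hi' => ?_, fun _ => by omega⟩
      have : i' ≠ 1 := by rintro rfl; exact h1 hi'
      omega
    · obtain ⟨i, hi⟩ := exists_hasEdge_nil hH hinv h2
      obtain rfl : i = k - 1 := (hidx i hi).resolve_left fun h => hex ⟨i, h.2, hi⟩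
      exact htwins 1 2 (by omega) (hi.mem_vertexSet ((hstar _).2 (by omega)))
        (hi.mem_vertexSet ((hstar _).2 (by omega)))
        ⟨fun i' _ hi'm hi' => (hex ⟨i', hi'm, hi'⟩).elim, fun _ => by omega⟩
  have hi : ∀ i, 1 ≤ i → i ≤ k - 2 → i ≠ k - 3 → HasEdge H k s [] i := by
    intro i hi1 him hik
    by_contra hn
    have : i ≠ 1 := by rintro rfl; exact hn h1
    -- `M*` contains both or neither of `v_{i-1}`, `v_i`, except for `i = k - 3`, where `M*`
    -- contains `v_{k-4}` but not `v_{k-3}`.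
    refine htwins (i - 1) i (by omega)
      (h1.mem_vertexSet ((mem_copyEdge_nil (by omega) (by omega)).2 (by omega)))
      (h1.mem_vertexSet ((mem_copyEdge_nil (by omega) (by omega)).2 (by omega)))
      ⟨fun i' hi'1 hi'm hi' => ?_, fun _ => by omega⟩
    have : i' ≠ i := by rintro rfl; exact hn hi'
    omega
  have hk3 : HasEdge H k s [] (k - 3) := by
    by_contra hn
    -- Without `M_{m-1}` no `M_i` separates the last two vertices `v_{2k-6}`, `v_{2k-5}`, and for `k
    -- > 6` neither is in `M*`. For `k = 6` the vertex `v_{2k-6} = v_k` does lie in `M*`, so another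
    -- symmetry is needed.
    by_cases hk6 : k = 6
    · subst hk6
      by_cases h5 : HasEdge H 6 s [] 5
      · exact hinv (hasInvolution_of_starSwap hH hinv h1 (hi 2 (by omega) (by omega) (by omega))
          hn (hi 4 (by omega) (by omega) (by omega)) h5)
      · refine htwins 2 3 (by omega)
          (h1.mem_vertexSet ((mem_copyEdge_nil (by omega) (by omega)).2 (by omega)))
          (h1.mem_vertexSet ((mem_copyEdge_nil (by omega) (by omega)).2 (by omega)))
          ⟨fun i' hi'1 hi'm hi' => ?_, fun h => (h5 h).elim⟩
        have : i' ≠ 3 := by rintro rfl; exact hn hi'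
        omega
    · have hlast := hi (k - 2) (by omega) le_rfl (by omega)
      refine htwins (2 * k - 6) (2 * k - 5) (by omega)
        (hlast.mem_vertexSet ((mem_copyEdge_nil (by omega) (by omega)).2 (by omega)))
        (hlast.mem_vertexSet ((mem_copyEdge_nil (by omega) (by omega)).2 (by omega)))
        ⟨fun i' hi'1 hi'm hi' => ?_, fun _ => by omega⟩
      have : i' ≠ k - 3 := by rintro rfl; exact hn hi'
      omega
  have hi : ∀ i, 1 ≤ i → i ≤ k - 2 → HasEdge H k s [] i := fun i hi1 him => by
    by_cases h : i = k - 3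
    · rwa [h]
    · exact hi i hi1 him h
  refine hne (eq_layered_of_hasEdge_nil hH hinv fun i hidx' => ?_)
  by_cases him : i ≤ k - 2
  · exact hi i hidx'.2.1 him
  obtain rfl : i = k - 1 := by have := isEdgeIndex_nil.1 hidx'; omega
  by_contra hn
  have hsize : copySize k s [] = k - 2 := copySize_nil
  have hrefl : ∀ i, 1 ≤ i → i ≤ k - 2 → HasEdge H k s [] (reflect (k - 2) i) :=
    fun i hi1 him => by
      refine hi _ ?_ ?_ <;> unfold reflect <;> split_ifs <;> omega
  have hmem : ∀ i j, 1 ≤ i → i ≤ k - 2 → (j ∈ copyEdge k s [] i ↔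
      reflect (2 * (k - 2) - 1) j ∈ copyEdge k s [] (reflect (k - 2) i)) := fun i j hi1 him => by
    have := mem_copyEdge_reflect (j := j) (p := []) (s := s) hi1 (by rwa [hsize])
    rwa [hsize] at this
  -- Only `M*` is missing, and the top copy is reversed as a `G_{k-2}`; the vertex `x`, possibly
  -- isolated in `H`, stays fixed.
  refine hinv (hasInvolution_of_blockMap hH (reflect_involutive (k - 2))
    (reflect_involutive (2 * (k - 2) - 1)) (isUniformBelow hH hinv []) (fun i hi' => ?_)
    (fun i hi' => ?_) (fun j hj => ?_) ⟨1, ?_, ?_⟩ (by simp))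
  · rcases hidx i hi' with ⟨hi1, him⟩ | rfl
    · exact ⟨hrefl i hi1 him, fun j => hmem i j hi1 him⟩
    · exact (hn hi').elim
  · by_cases him : i ≤ k - 2
    · exact .inr (hi i hi'.2.1 him)
    · exact .inl (by simp [reflect, him])
  · obtain ⟨i, hi', hji⟩ := exists_mem_copyEdge hk (hH.1 hj)
    by_cases him : i ≤ k - 2
    · exact (hrefl i hi'.2.1 him).mem_vertexSet ((hmem i j hi'.2.1 him).1 hji)
    · have hj2 := (mem_copyVerts_nil hk).1 ((mem_vertexSet_layered hk).1 (hH.1 hj)).2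
      by_cases hj0 : 1 ≤ j
      · by_cases hjk : j ≤ k - 2
        · exact (hrefl 1 le_rfl (by omega)).mem_vertexSet ((hmem 1 j le_rfl (by omega)).1
            ((mem_copyEdge_nil le_rfl (by omega)).2 (by omega)))
        · exact (hrefl (k - 2) (by omega) le_rfl).mem_vertexSet
            ((hmem (k - 2) j (by omega) le_rfl).1
            ((mem_copyEdge_nil (by omega) le_rfl).2 (by omega)))
      · have h0 : reflect (2 * (k - 2) - 1) j = j := by simp [reflect, hj0]
        rwa [h0]
  · exact h1.mem_vertexSet ((mem_copyEdge_nil le_rfl (by omega)).2 (by omega))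
  · unfold reflect; split_ifs <;> omega

end Star

/-! ### `G_{k,s}` is a `k`-graph -/

section KGraph

variable {k s : ℕ}

theorem copyNumEdges_le (p : List ℕ) : copyNumEdges k s p ≤ k := by
  unfold copyNumEdges; split_ifs <;> omega

theorem finite_setOf_isCopy (k s : ℕ) : {p | IsCopy k s p}.Finite := by
  have h : ∀ n, {p | IsCopy k s p ∧ p.length = n}.Finite := by
    intro n
    induction n with
    | zero => exact (Set.finite_singleton []).subset fun p hp => by simpa using hp.2
    | succ n ih =>
      refine (Set.Finite.image2 List.cons (Set.finite_Iic k) ih).subset ?_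
      rintro (_ | ⟨a, p⟩) ⟨hp, hl⟩
      · simp at hl
      · exact ⟨a, hp.isEdgeIndex.2.2.trans (copyNumEdges_le p), p,
          ⟨hp.isEdgeIndex.1, by simpa using hl⟩, rfl⟩
  refine ((Set.finite_Iic (s + 1)).biUnion fun n _ => h n).subset fun p hp => ?_
  simp only [Set.mem_iUnion]
  exact ⟨p.length, IsCopy.length_le hp, hp, rfl⟩

theorem finite_vertexSet_layered (hk : 6 ≤ k) : V(layered k s hk).Finite := by
  refine ((finite_setOf_isCopy k s).prod (Set.finite_Iic (2 * k))).subset ?_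
  rintro ⟨p, j⟩ ⟨hp, hj⟩
  refine ⟨hp, ?_⟩
  change j ∈ copyVerts k s p at hj
  change j ≤ 2 * k
  unfold copyVerts starVerts blockVerts at hj
  split_ifs at hj <;> simp at hj <;> omega

theorem ncard_natIcc (a b : ℕ) : (Set.Icc a b).ncard = b + 1 - a := by
  rw [← Finset.coe_Icc, Set.ncard_coe_finset, Nat.card_Icc]

theorem ncard_prodMk_image (p : List ℕ) (S : Set ℕ) : (Prod.mk p '' S).ncard = S.ncard :=
  Set.ncard_image_of_injective _ (Prod.mk_right_injective p)

theorem ncard_copyEdge (hk : 6 ≤ k) {p : List ℕ} {i : ℕ} (h : IsEdgeIndex k s p i) :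
    (copyEdge k s p i).ncard = copySize k s p ∧ (copyEdge k s p i).Finite := by
  have h4 := four_le_copySize (s := s) (p := p) hk
  rcases h.le_copySize_or hk with him | ⟨rfl, rfl⟩
  · have : copyEdge k s p i = Set.Icc i (i + copySize k s p - 1) := by
      ext j
      rw [mem_copyEdge h.2.1 him, Set.mem_Icc]
      omega
    rw [this, ncard_natIcc]
    exact ⟨by omega, Set.finite_Icc _ _⟩
  · have : copyEdge k s [] (k - 1) = insert 0 (insert k (Set.Icc 1 (k - 4))) := by
      ext j
      simp [mem_copyEdge_star hk]
    have hfin : (Set.Icc 1 (k - 4)).Finite := Set.finite_Icc _ _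
    rw [this, copySize_nil, Set.ncard_insert_of_notMem (by simp; omega) (hfin.insert k),
      Set.ncard_insert_of_notMem (by simp; omega) hfin, ncard_natIcc]
    exact ⟨by omega, (hfin.insert k).insert 0⟩

theorem ncard_layeredEdge (hk : 6 ≤ k) {p : List ℕ} {i : ℕ} (h : IsEdgeIndex k s p i) :
    (layeredEdge k s p i).ncard = k := by
  obtain ⟨hc, hfin⟩ := ncard_copyEdge hk h
  by_cases hl : p.length = s + 1
  · simp only [layeredEdge, hl, if_true, Set.union_empty]
    rw [ncard_prodMk_image, hc]
    simp [copySize, hl]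
  · have h4 := four_le_copySize (s := s) (p := i :: p) hk
    have hpair : copyLastTwo k s (i :: p) =
        {2 * copySize k s (i :: p) - 2, 2 * copySize k s (i :: p) - 1} := by
      ext j; simp [mem_copyLastTwo]
    simp only [layeredEdge, hl, if_false]
    rw [Set.ncard_union_eq _ (hfin.image _) ((by rw [hpair]; simp : Set.Finite _).image _),
      ncard_prodMk_image, ncard_prodMk_image, hc, hpair, Set.ncard_pair (by omega)]
    · simp only [copySize, hl, if_false]
      omega
    · rw [Set.disjoint_left]
      rintro _ ⟨j, -, rfl⟩ ⟨j', -, h⟩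
      simpa using congrArg Prod.fst h

theorem isKGraph_layered (hk : 6 ≤ k) : (layered k s hk).IsKGraph k := by
  refine ⟨finite_vertexSet_layered hk, fun e he => ?_⟩
  obtain ⟨p, i, h, rfl⟩ := (mem_edgeSet_layered hk).1 he
  exact ncard_layeredEdge hk h

theorem finite_edgeSet_layered (hk : 6 ≤ k) : E(layered k s hk).Finite :=
  (finite_vertexSet_layered hk).finite_subsets.subset fun _ he => he.subset_vertexSet

/-! ### Different `s` give different numbers of vertices -/

theorem isCopy_of_le {t : ℕ} (hst : s ≤ t) {p : List ℕ} (h : IsCopy k s p) : IsCopy k t p := by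
  induction h with
  | nil => exact .nil
  | cons i p hp hl hi hi' ih =>
    refine .cons i p ih (by omega) hi (hi'.trans ?_)
    unfold copyNumEdges
    split_ifs <;> omega

theorem ncard_vertexSet_layered_lt {t : ℕ} (hk : 6 ≤ k) (hst : s < t) :
    V(layered k s hk).ncard < V(layered k t hk).ncard := by
  -- A copy of length `s + 1` is a `G_k` for `s` but a `G_{k-2}` with `2k - 5` vertices for `t`. Its
  -- four surplus vertices go to the first four vertices of its child number `1`; the child number
  -- `2` of such a copy is never hit.
  let f : List ℕ × ℕ → List ℕ × ℕ := fun x =>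
    if x.1.length = s + 1 ∧ 2 * k - 5 < x.2 then (1 :: x.1, x.2 - (2 * k - 5)) else x
  have hf : Set.InjOn f V(layered k s hk) := by
    rintro ⟨p, j⟩ hx ⟨q, l⟩ hy hxy
    have hpl := IsCopy.length_le hx.1
    have hql := IsCopy.length_le hy.1
    simp only [f] at hxy hpl hql
    split_ifs at hxy with h1 h2 h2 <;> simp only [Prod.mk.injEq] at hxy
    · obtain ⟨h3, h4⟩ := hxy
      simp only [List.cons.injEq, true_and] at h3
      rw [Prod.mk.injEq]
      exact ⟨h3, by omega⟩
    · have := congrArg List.length hxy.1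
      simp only [List.length_cons] at this
      omega
    · have := congrArg List.length hxy.1
      simp only [List.length_cons] at this
      omega
    · rw [hxy.1, hxy.2]
  have hones : ∀ n, n ≤ s + 1 → IsCopy k s (List.replicate n 1) := by
    intro n hn
    induction n with
    | zero => exact .nil
    | succ n ih =>
      refine .cons 1 _ (ih (by omega)) (by simp; omega) le_rfl ?_
      unfold copyNumEdges
      split_ifs <;> omega
  have hsub : f '' V(layered k s hk) ⊂ V(layered k t hk) := by
    refine (Set.ssubset_iff_of_subset ?_).2 ⟨(2 :: List.replicate (s + 1) 1, 1), ?_, ?_⟩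
    · rintro _ ⟨⟨p, j⟩, ⟨hp, hj⟩, rfl⟩
      change j ∈ copyVerts k s p at hj
      simp only at hp
      have hp' : IsCopy k t p := isCopy_of_le hst.le hp
      have hl := hp.length_le
      simp only [f]
      split_ifs with h
      · have hne : p ≠ [] := by rintro rfl; simp at h
        rw [mem_copyVerts_of_ne_nil hne, copySize, if_pos h.1] at hj
        refine ⟨.cons 1 p hp' (by omega) le_rfl ?_, ?_⟩
        · unfold copyNumEdges; split_ifs <;> omega
        · change _ ∈ copyVerts k t (1 :: p)
          rw [mem_copyVerts_of_ne_nil (by simp)]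
          have := four_le_copySize (s := t) (p := 1 :: p) hk
          simp only
          omega
      · refine ⟨hp', ?_⟩
        change j ∈ copyVerts k t p
        by_cases hne : p = []
        · subst hne
          rw [mem_copyVerts_nil hk] at hj ⊢
          exact hj
        · rw [mem_copyVerts_of_ne_nil hne] at hj ⊢
          unfold copySize at hj ⊢
          split_ifs at hj ⊢ <;> omega
    · refine ⟨.cons 2 _ (isCopy_of_le hst.le (hones (s + 1) le_rfl)) (by simp; omega) (by omega) ?_,
        ?_⟩
      · unfold copyNumEdges; split_ifs <;> omega
      · change 1 ∈ copyVerts k t (2 :: List.replicate (s + 1) 1)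
        rw [mem_copyVerts_of_ne_nil (by simp)]
        have := four_le_copySize (s := t) (p := 2 :: List.replicate (s + 1) 1) hk
        omega
    · rintro ⟨⟨p, j⟩, ⟨hp, -⟩, hx⟩
      have hl := IsCopy.length_le hp
      simp only [f] at hx hl
      split_ifs at hx with h
      · simp at hx
      · have := congrArg (List.length ∘ Prod.fst) hx
        simp only [Function.comp_apply, List.length_cons, List.length_replicate] at this
        omega
  rw [← Set.InjOn.ncard_image hf]
  exact Set.ncard_lt_ncard hsub (finite_vertexSet_layered hk)

theorem not_isomorphic_layered {t : ℕ} (hk : 6 ≤ k) (hst : s ≠ t) :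
    ¬ (layered k s hk).Isomorphic (layered k t hk) := by
  rintro ⟨φ, -⟩
  have h : V(layered k s hk).ncard = V(layered k t hk).ncard := by
    rw [← Nat.card_coe_set_eq, ← Nat.card_coe_set_eq]
    exact Nat.card_congr φ
  rcases lt_or_gt_of_ne hst with h' | h'
  · exact (ncard_vertexSet_layered_lt hk h').ne h
  · exact (ncard_vertexSet_layered_lt hk h').ne' h

end KGraph

/-! ### The action of an automorphism on the edges -/

section Automorphism

variable {α : Type*} {H : Hypergraph α} {φ : V(H) ≃ V(H)} {e f : Set α}

/-- The image of a set of vertices under an automorphism. -/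
def mapEdge (φ : V(H) ≃ V(H)) (e : Set α) : Set α :=
  Subtype.val '' (φ '' (Subtype.val ⁻¹' e))

theorem IsIso.mapEdge_mem (hφ : IsIso φ) (he : e ∈ E(H)) : mapEdge φ e ∈ E(H) := by
  refine (hφ _).1 ?_
  rwa [Subtype.image_preimage_coe, Set.inter_eq_right.2 he.subset_vertexSet]

theorem mem_mapEdge (x : V(H)) : (φ x : α) ∈ mapEdge φ e ↔ (x : α) ∈ e := by
  simp [mapEdge]

theorem exists_of_mem_mapEdge {y : α} (h : y ∈ mapEdge φ e) :
    ∃ x : V(H), (x : α) ∈ e ∧ (φ x : α) = y := by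
  obtain ⟨_, ⟨x, hx, rfl⟩, rfl⟩ := h
  exact ⟨x, hx, rfl⟩

theorem mapEdge_injOn : Set.InjOn (mapEdge φ) E(H) := by
  intro e he f hf h
  refine (edgeSet.ext_iff he hf).2 fun x hx => ?_
  rw [← mem_mapEdge (φ := φ) ⟨x, hx⟩, h, mem_mapEdge]

theorem IsIso.exists_mapEdge_eq (hφ : IsIso φ) (he : e ∈ E(H)) :
    ∃ f ∈ E(H), mapEdge φ f = e := by
  refine ⟨Subtype.val '' (φ ⁻¹' (Subtype.val ⁻¹' e)), (hφ _).2 ?_, ?_⟩ <;>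
  simp only [mapEdge, Set.preimage_image_eq _ Subtype.val_injective,
    Set.image_preimage_eq _ φ.surjective, Subtype.image_preimage_coe]
  · rwa [Set.inter_eq_right.2 he.subset_vertexSet]
  · exact Set.inter_eq_right.2 he.subset_vertexSet

theorem ncard_mapEdge_inter (he : e ∈ E(H)) :
    (mapEdge φ e ∩ mapEdge φ f).ncard = (e ∩ f).ncard := by
  have h1 : mapEdge φ e ∩ mapEdge φ f = mapEdge φ (e ∩ f) := by
    simp only [mapEdge, Set.preimage_inter, Set.image_inter φ.injective,
      Set.image_inter Subtype.val_injective]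
  rw [h1, mapEdge, Set.ncard_image_of_injective _ Subtype.val_injective,
    Set.ncard_image_of_injective _ φ.injective,
    ← Set.ncard_image_of_injective _ Subtype.val_injective, Subtype.image_preimage_coe,
    Set.inter_eq_right.2 (Set.inter_subset_left.trans he.subset_vertexSet)]

/-- The number of edges that contain `x`. -/
noncomputable def degree (H : Hypergraph α) (x : α) : ℕ := {e ∈ E(H) | x ∈ e}.ncard

theorem IsIso.degree_eq (hφ : IsIso φ) (x : V(H)) : H.degree (φ x) = H.degree x := by
  have : {e ∈ E(H) | (φ x : α) ∈ e} = mapEdge φ '' {e ∈ E(H) | (x : α) ∈ e} := by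
    ext e
    constructor
    · rintro ⟨he, hx⟩
      obtain ⟨f, hf, rfl⟩ := hφ.exists_mapEdge_eq he
      exact ⟨f, ⟨hf, (mem_mapEdge x).1 hx⟩, rfl⟩
    · rintro ⟨f, ⟨hf, hx⟩, rfl⟩
      exact ⟨hφ.mapEdge_mem hf, (mem_mapEdge x).2 hx⟩
  rw [degree, this, Set.InjOn.ncard_image (mapEdge_injOn.mono fun e he => he.1), degree]

/-- If no two vertices lie in the same edges, then an automorphism that fixes all edges is the
identity. -/
theorem eq_refl_of_mapEdge_eq (hH : ∀ x ∈ V(H), ∀ y ∈ V(H), (∀ e ∈ E(H), x ∈ e ↔ y ∈ e) → x = y)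
    (h : ∀ e ∈ E(H), mapEdge φ e = e) : φ = Equiv.refl _ := by
  ext x
  refine hH _ (φ x).2 _ x.2 fun e he => ?_
  conv_lhs => rw [← h e he]
  exact mem_mapEdge x

end Automorphism

/-! ### `G_{k,s}` is asymmetric -/

section Asymmetric

variable {k s : ℕ} {p q : List ℕ} {i j l : ℕ}

theorem IsEdgeIndex.exists_mem (hk : 6 ≤ k) (h : IsEdgeIndex k s p i) :
    ∃ j, j ∈ copyEdge k s p i := by
  have h4 := four_le_copySize (s := s) (p := p) hk
  rcases h.le_copySize_or hk with him | ⟨rfl, rfl⟩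
  · exact ⟨i, (mem_copyEdge h.2.1 him).2 (by omega)⟩
  · exact ⟨0, (mem_copyEdge_star hk).2 (.inl rfl)⟩

theorem layeredEdge_injective (hk : 6 ≤ k) (hp : IsEdgeIndex k s p i) (hq : IsEdgeIndex k s q l)
    (h : layeredEdge k s p i = layeredEdge k s q l) : p = q ∧ i = l := by
  have hpq : p = q := by
    obtain ⟨a, ha⟩ := hp.exists_mem hk
    obtain ⟨b, hb⟩ := hq.exists_mem hk
    have h1 : (p, a) ∈ layeredEdge k s q l := h ▸ mem_layeredEdge_self.2 ha
    have h2 : (q, b) ∈ layeredEdge k s p i := h ▸ mem_layeredEdge_self.2 hb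
    rw [mem_layeredEdge] at h1 h2
    rcases h1 with h1 | h1
    · exact h1.1
    rcases h2 with h2 | h2
    · exact h2.1.symm
    have h3 := congrArg List.length h1.2.1
    have h4 := congrArg List.length h2.2.1
    simp only [List.length_cons] at h3 h4
    omega
  subst hpq
  refine ⟨rfl, ?_⟩
  have h' : ∀ j, j ∈ copyEdge k s p i ↔ j ∈ copyEdge k s p l := fun j => by
    rw [← mem_layeredEdge_self, h, mem_layeredEdge_self]
  have h4 := four_le_copySize (s := s) (p := p) hk
  have h1p := hp.2.1
  have h1q := hq.2.1
  rcases hp.le_copySize_or hk with hi | ⟨rfl, rfl⟩ <;> rcases hq.le_copySize_or hk with hl | ⟨h0, rfl⟩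
  · have h1 := h' i
    have h2 := h' l
    rw [mem_copyEdge h1p hi, mem_copyEdge h1q hl] at h1 h2
    omega
  · subst h0
    have h1 := h' 0
    rw [mem_copyEdge h1p hi, mem_copyEdge_star hk] at h1
    omega
  · have h1 := h' 0
    rw [mem_copyEdge h1q hl, mem_copyEdge_star hk] at h1
    omega
  · rfl

theorem exists_separating_copyEdge (hk : 6 ≤ k) (hj : (p, j) ∈ V(layered k s hk))
    (hl : (p, l) ∈ V(layered k s hk)) (hjl : j < l) :
    ∃ i, IsEdgeIndex k s p i ∧ ¬ (j ∈ copyEdge k s p i ↔ l ∈ copyEdge k s p i) := by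
  have h4 := four_le_copySize (s := s) (p := p) hk
  have hl' : l ≤ 2 * copySize k s p - 1 := by
    by_cases hp : p = []
    · subst hp
      rw [copySize_nil]
      exact (mem_copyVerts_nil hk).1 hl.2
    · exact ((mem_copyVerts_of_ne_nil hp).1 hl.2).2
  obtain ⟨i, hi, him, h⟩ : ∃ i, 1 ≤ i ∧ i ≤ copySize k s p ∧
      ¬ (i ≤ j ∧ j < i + copySize k s p ↔ i ≤ l ∧ l < i + copySize k s p) := by
    by_cases hlm : l ≤ copySize k s p
    · exact ⟨l, by omega, hlm, by omega⟩
    by_cases hjm : copySize k s p ≤ j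
    · exact ⟨j + 1 - copySize k s p, by omega, by omega, by omega⟩
    · exact ⟨copySize k s p, by omega, le_rfl, by omega⟩
  exact ⟨i, .of_le_copySize hj.1 hi him, by rwa [mem_copyEdge hi him, mem_copyEdge hi him]⟩

/-- No two vertices of `G_{k,s}` lie in the same edges. -/
theorem eq_of_forall_mem_iff (hk : 6 ≤ k) {x y : List ℕ × ℕ} (hx : x ∈ V(layered k s hk))
    (hy : y ∈ V(layered k s hk)) (h : ∀ e ∈ E(layered k s hk), x ∈ e ↔ y ∈ e) : x = y := by
  obtain ⟨p, j⟩ := x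
  obtain ⟨q, l⟩ := y
  by_cases hpq : p = q
  · subst hpq
    have hiff : ∀ i, IsEdgeIndex k s p i → (j ∈ copyEdge k s p i ↔ l ∈ copyEdge k s p i) :=
      fun i hi => by
        rw [← mem_layeredEdge_self, ← mem_layeredEdge_self]
        exact h _ (hi.mem_edgeSet hk)
    rcases lt_trichotomy j l with hjl | rfl | hjl
    · obtain ⟨i, hi, hn⟩ := exists_separating_copyEdge hk hx hy hjl
      exact (hn (hiff i hi)).elim
    · rfl
    · obtain ⟨i, hi, hn⟩ := exists_separating_copyEdge hk hy hx hjl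
      exact (hn (hiff i hi).symm).elim
  · obtain ⟨a, ha, hja⟩ := exists_mem_copyEdge hk hx
    obtain ⟨b, hb, hlb⟩ := exists_mem_copyEdge hk hy
    have h1 := (h _ (ha.mem_edgeSet hk)).1 (mem_layeredEdge_self.2 hja)
    have h2 := (h _ (hb.mem_edgeSet hk)).2 (mem_layeredEdge_self.2 hlb)
    rw [mem_layeredEdge] at h1 h2
    have h3 := congrArg List.length (h1.resolve_left fun h => hpq h.1.symm).2.1
    have h4 := congrArg List.length (h2.resolve_left fun h => hpq h.1).2.1
    simp only [List.length_cons] at h3 h4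
    omega

/-! #### Degrees -/

theorem degree_le_card (hk : 6 ≤ k) {x : List ℕ × ℕ} (S : Finset (List ℕ × ℕ))
    (h : ∀ p i, IsEdgeIndex k s p i → x ∈ layeredEdge k s p i → (p, i) ∈ S) :
    (layered k s hk).degree x ≤ S.card := by
  have hsub : {e ∈ E(layered k s hk) | x ∈ e} ⊆
      (fun y : List ℕ × ℕ => layeredEdge k s y.1 y.2) '' S := by
    rintro e ⟨he, hx⟩
    obtain ⟨p, i, hi, rfl⟩ := (mem_edgeSet_layered hk).1 he
    exact ⟨(p, i), h p i hi hx, rfl⟩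
  refine (Set.ncard_le_ncard hsub (S.finite_toSet.image _)).trans ?_
  exact (Set.ncard_image_le S.finite_toSet).trans (Set.ncard_coe_finset S).le

theorem copySize_le_degree (hk : 6 ≤ k) (hp : IsCopy k s p) :
    copySize k s p ≤ (layered k s hk).degree (p, copySize k s p) := by
  have h4 := four_le_copySize (s := s) (p := p) hk
  have hinj : Set.InjOn (layeredEdge k s p) (Set.Icc 1 (copySize k s p)) := fun i hi l hl h =>
    (layeredEdge_injective hk (.of_le_copySize hp hi.1 hi.2) (.of_le_copySize hp hl.1 hl.2) h).2
  have hcard := hinj.ncard_image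
  rw [ncard_natIcc, Nat.add_sub_cancel] at hcard
  rw [← hcard]
  refine Set.ncard_le_ncard ?_ ((finite_edgeSet_layered hk).subset fun e he => he.1)
  rintro _ ⟨i, ⟨hi, him⟩, rfl⟩
  rw [hcard]
  exact ⟨(IsEdgeIndex.of_le_copySize hp hi him).mem_edgeSet hk,
    mem_layeredEdge_self.2 ((mem_copyEdge hi him).2 (by omega))⟩

/-- The edges of `G_m` that contain `v_j`, as edges of the copy `q`. -/
def ownEdges (k s : ℕ) (q : List ℕ) (j : ℕ) : Finset (List ℕ × ℕ) :=
  (Finset.Icc (max 1 (j + 1 - copySize k s q)) (min j (copySize k s q))).image (Prod.mk q)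

theorem card_ownEdges_le : (ownEdges k s q j).card ≤
    min j (copySize k s q) + 1 - max 1 (j + 1 - copySize k s q) :=
  Finset.card_image_le.trans (Nat.card_Icc _ _).le

theorem mem_ownEdges_or (hk : 6 ≤ k) (h : IsEdgeIndex k s p i)
    (hmem : (q, j) ∈ layeredEdge k s p i) :
    (p, i) ∈ ownEdges k s q j ∨ (q = [] ∧ j ∈ copyEdge k s [] (k - 1) ∧ p = [] ∧ i = k - 1) ∨
      (q = i :: p ∧ j ∈ copyLastTwo k s q) := by
  rcases mem_layeredEdge.1 hmem with ⟨rfl, hj⟩ | ⟨-, rfl, hj⟩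
  · rcases h.le_copySize_or hk with him | ⟨rfl, rfl⟩
    · left
      rw [mem_copyEdge h.2.1 him] at hj
      have := h.2.1
      simp only [ownEdges, Finset.mem_image, Finset.mem_Icc, Prod.mk.injEq, true_and]
      exact ⟨i, by omega, rfl⟩
    · exact .inr (.inl ⟨rfl, hj, rfl, rfl⟩)
  · exact .inr (.inr ⟨rfl, hj⟩)

theorem degree_le_ownEdges (hk : 6 ≤ k) (hstar : q = [] → j ∉ copyEdge k s [] (k - 1))
    (hlast : j ∉ copyLastTwo k s q) : (layered k s hk).degree (q, j) ≤
      min j (copySize k s q) + 1 - max 1 (j + 1 - copySize k s q) := by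
  refine (degree_le_card hk (ownEdges k s q j) fun p i hi hmem => ?_).trans card_ownEdges_le
  rcases mem_ownEdges_or hk hi hmem with h | h | h
  · exact h
  · exact (hstar h.1 h.2.1).elim
  · exact (hlast h.2).elim

theorem degree_le_ownEdges_add_one (hk : 6 ≤ k) (q : List ℕ) (j : ℕ) :
    (layered k s hk).degree (q, j) ≤
      min j (copySize k s q) + 1 - max 1 (j + 1 - copySize k s q) + 1 := by
  -- At most one further edge is possible: the one from `M*` for the top copy, the one `q` is
  -- attached to otherwise.
  obtain ⟨y, hy⟩ : ∃ y : List ℕ × ℕ, ∀ p i, (q = [] ∧ p = [] ∧ i = k - 1) ∨ q = i :: p →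
      (p, i) = y := by
    cases q with
    | nil => exact ⟨([], k - 1), by simp⟩
    | cons a q =>
      refine ⟨(q, a), fun p i h => ?_⟩
      obtain ⟨rfl, rfl⟩ := List.cons_eq_cons.1 (h.resolve_left (by simp))
      rfl
  refine (degree_le_card hk (insert y (ownEdges k s q j)) fun p i hi hmem => ?_).trans
    ((Finset.card_insert_le _ _).trans (Nat.add_le_add_right card_ownEdges_le 1))
  rw [Finset.mem_insert]
  rcases mem_ownEdges_or hk hi hmem with h | h | h
  · exact .inr h
  · exact .inl (hy p i (.inl ⟨h.1, h.2.2⟩))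
  · exact .inl (hy p i (.inr h.1))

theorem degree_le_three (hk : 6 ≤ k) (hj : j ∈ copyLastTwo k s q) :
    (layered k s hk).degree (q, j) ≤ 3 := by
  have h4 := four_le_copySize (s := s) (p := q) hk
  have h := degree_le_ownEdges_add_one (s := s) hk q j
  rw [mem_copyLastTwo] at hj
  omega

/-- Going from `v_m` to `v_{2m-1}`, each step loses one `M_i`, and at most one further edge can
compensate. It could restore degree `m` only at `v_{m+1}`, which lies neither in `M*` nor among the
last two vertices. -/
theorem degree_lt_of_mem_lastEdge (hk : 6 ≤ k) {x : List ℕ × ℕ}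
    (hx : x ∈ layeredEdge k s q (copySize k s q)) (hne : x ≠ (q, copySize k s q)) :
    (layered k s hk).degree x < copySize k s q := by
  have h4 := four_le_copySize (s := s) (p := q) hk
  obtain ⟨t, j⟩ := x
  rcases mem_layeredEdge.1 hx with ⟨rfl, hj⟩ | ⟨-, rfl, hj⟩
  · rw [mem_copyEdge (by omega) le_rfl] at hj
    have hj' : j ≠ copySize k s t := fun h => hne (by rw [h])
    by_cases hj1 : j = copySize k s t + 1
    · have h := degree_le_ownEdges (s := s) (q := t) (j := j) hk ?_ ?_
      · omega
      · rintro rfl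
        rw [copySize_nil] at hj1
        rw [mem_copyEdge_star hk]
        omega
      · rw [mem_copyLastTwo]
        omega
    · have h := degree_le_ownEdges_add_one (s := s) hk t j
      omega
  · have := degree_le_three hk hj
    omega

theorem degree_lt_of_mem_star (hk : 6 ≤ k) {x : List ℕ × ℕ}
    (hx : x ∈ layeredEdge k s [] (k - 1)) : (layered k s hk).degree x < k - 2 := by
  obtain ⟨t, j⟩ := x
  rcases mem_layeredEdge.1 hx with ⟨rfl, hj⟩ | ⟨-, rfl, hj⟩
  · have h := degree_le_ownEdges_add_one (s := s) hk [] j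
    rw [mem_copyEdge_star hk] at hj
    rw [copySize_nil] at h
    omega
  · have := degree_le_three hk hj
    omega

/-! #### Automorphisms fix all edges -/

theorem mem_copyEdge_last (hk : 6 ≤ k) (hj : j ∈ copyLastTwo k s q) :
    j ∈ copyEdge k s q (copySize k s q) := by
  have h4 := four_le_copySize (s := s) (p := q) hk
  rw [mem_copyLastTwo] at hj
  rw [mem_copyEdge (by omega) le_rfl]
  omega

theorem ncard_inter_lastEdge (hi : 1 ≤ i) (him : i < copySize k s q) :
    (layeredEdge k s q i ∩ layeredEdge k s q (copySize k s q)).ncard = i := by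
  have h : layeredEdge k s q i ∩ layeredEdge k s q (copySize k s q) =
      Prod.mk q '' Set.Icc (copySize k s q) (i + copySize k s q - 1) := by
    ext ⟨t, j⟩
    simp only [Set.mem_inter_iff, mem_layeredEdge, Set.mem_image, Set.mem_Icc, Prod.mk.injEq]
    rw [mem_copyEdge hi him.le, mem_copyEdge (by omega) le_rfl]
    constructor
    · rintro ⟨⟨rfl, h1⟩ | ⟨-, rfl, h1⟩, ⟨h0, h2⟩ | ⟨-, h0, h2⟩⟩
      · exact ⟨j, by omega, rfl, rfl⟩
      · simp at h0
      · simp at h0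
      · simp only [List.cons.injEq, and_true] at h0
        omega
    · rintro ⟨j, hj, rfl, rfl⟩
      exact ⟨.inl ⟨rfl, by omega⟩, .inl ⟨rfl, by omega⟩⟩
  rw [h, ncard_prodMk_image, ncard_natIcc]
  omega

variable {hk : 6 ≤ k} {φ : V(layered k s hk) ≃ V(layered k s hk)}

theorem IsIso.exists_mapEdge_layeredEdge (hφ : IsIso φ) (h : IsEdgeIndex k s p i) :
    ∃ q l, IsEdgeIndex k s q l ∧ mapEdge φ (layeredEdge k s p i) = layeredEdge k s q l :=
  (mem_edgeSet_layered hk).1 (hφ.mapEdge_mem (h.mem_edgeSet hk))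

/-- If the image of an edge is a fixed edge, then the edge is fixed. -/
theorem eq_of_mapEdge_eq (hp : IsEdgeIndex k s p i) (hq : IsEdgeIndex k s q l)
    (h : mapEdge φ (layeredEdge k s p i) = layeredEdge k s q l)
    (hfix : mapEdge φ (layeredEdge k s q l) = layeredEdge k s q l) : p = q ∧ i = l :=
  layeredEdge_injective hk hp hq
    (mapEdge_injOn (φ := φ) (hp.mem_edgeSet hk) (hq.mem_edgeSet hk) (h.trans hfix.symm))

/-- Any other edge contains the centre of its copy, of degree at least `k - 2`, whereas all vertices
of this edge have smaller degree. -/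
theorem IsIso.mapEdge_star (hφ : IsIso φ) :
    mapEdge φ (layeredEdge k s [] (k - 1)) = layeredEdge k s [] (k - 1) := by
  obtain ⟨p, i, hi, h⟩ := hφ.exists_mapEdge_layeredEdge (isEdgeIndex_star hk)
  rcases hi.le_copySize_or hk with him | ⟨rfl, rfl⟩
  · have h4 := four_le_copySize (s := s) (p := p) hk
    have h1 := hi.2.1
    have hmem : (p, copySize k s p) ∈ layeredEdge k s p i :=
      mem_layeredEdge_self.2 ((mem_copyEdge h1 him).2 (by omega))
    rw [← h] at hmem
    obtain ⟨x, hx, hxp⟩ := exists_of_mem_mapEdge hmem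
    have h2 := degree_lt_of_mem_star hk hx
    rw [← hφ.degree_eq x, hxp] at h2
    have h3 := copySize_le_degree hk hi.1
    have h5 := sub_two_le_copySize (k := k) (s := s) (p := p)
    omega
  · exact h

theorem IsIso.mapEdge_of_lastEdge (hφ : IsIso φ) (hq : IsCopy k s q)
    (h : mapEdge φ (layeredEdge k s q (copySize k s q)) = layeredEdge k s q (copySize k s q))
    (hi : 1 ≤ i) (him : i ≤ copySize k s q) :
    mapEdge φ (layeredEdge k s q i) = layeredEdge k s q i := by
  have h4 := four_le_copySize (s := s) (p := q) hk
  have hlast : IsEdgeIndex k s q (copySize k s q) := .of_le_copySize hq (by omega) le_rfl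
  have hidx : IsEdgeIndex k s q i := .of_le_copySize hq hi him
  have hcentre : ∀ i, 1 ≤ i → i ≤ copySize k s q →
      (q, copySize k s q) ∈ layeredEdge k s q i := fun i hi him =>
    mem_layeredEdge_self.2 ((mem_copyEdge hi him).2 (by omega))
  have hm := hcentre (copySize k s q) (by omega) le_rfl
  let v : V(layered k s hk) :=
    ⟨(q, copySize k s q), mem_vertexSet_of_mem_edgeSet (hlast.mem_edgeSet hk) hm⟩
  have hv : (φ v : List ℕ × ℕ) = (q, copySize k s q) := by
    by_contra hne
    have h1 : (φ v : List ℕ × ℕ) ∈ layeredEdge k s q (copySize k s q) := by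
      rw [← h]; exact (mem_mapEdge v).2 hm
    have h2 := degree_lt_of_mem_lastEdge hk h1 hne
    rw [hφ.degree_eq v] at h2
    exact h2.not_ge (copySize_le_degree hk hq)
  obtain ⟨t, l, hl, hmap⟩ := hφ.exists_mapEdge_layeredEdge hidx
  have hmem : (q, copySize k s q) ∈ layeredEdge k s t l := by
    rw [← hmap, ← hv]; exact (mem_mapEdge v).2 (hcentre i hi him)
  -- The centre is neither one of the last two vertices nor in `M*`, so the image is some `M_l` of
  -- the same copy.
  obtain ⟨rfl, hml⟩ : q = t ∧ copySize k s q ∈ copyEdge k s t l := by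
    rcases mem_layeredEdge.1 hmem with h | ⟨-, rfl, h⟩
    · exact h
    · rw [mem_copyLastTwo] at h; omega
  have hlm : l ≤ copySize k s q := by
    rcases hl.le_copySize_or hk with h | ⟨rfl, rfl⟩
    · exact h
    · rw [mem_copyEdge_star hk, copySize_nil] at hml; omega
  by_cases him' : i = copySize k s q
  · rw [him', h]
  have hlm' : l ≠ copySize k s q := by
    rintro rfl
    exact him' (eq_of_mapEdge_eq hidx hlast hmap h).2
  have hcard := ncard_mapEdge_inter (φ := φ) (f := layeredEdge k s q (copySize k s q))
    (hidx.mem_edgeSet hk)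
  rw [hmap, h, ncard_inter_lastEdge hl.2.1 (by omega), ncard_inter_lastEdge hi (by omega)] at hcard
  rw [hmap, hcard]

/-- A vertex of the edge `(p, i)` lies in another edge, unless it is the vertex `v_1` or
`v_{2m-1}` of its copy, or the additional vertex of the top copy. -/
theorem exists_other_edge (hk : 6 ≤ k) (hp : IsEdgeIndex k s p i) (him : i ≤ copySize k s p)
    {x : List ℕ × ℕ} (hx : x ∈ layeredEdge k s p i) (h1 : x ≠ (p, 1))
    (h2 : x ≠ (p, 2 * copySize k s p - 1)) :
    ∃ q l, IsEdgeIndex k s q l ∧ (q, l) ≠ (p, i) ∧ x ∈ layeredEdge k s q l := by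
  obtain ⟨t, j⟩ := x
  have hi := hp.2.1
  rcases mem_layeredEdge.1 hx with ⟨rfl, hj⟩ | ⟨hl, rfl, hj⟩
  · rw [mem_copyEdge hi him] at hj
    have h4 := four_le_copySize (s := s) (p := t) hk
    have h1' : j ≠ 1 := fun h => h1 (by rw [h])
    have h2' : j ≠ 2 * copySize k s t - 1 := fun h => h2 (by rw [h])
    obtain ⟨l, hl1, hlm, hli, hjl⟩ : ∃ l, 1 ≤ l ∧ l ≤ copySize k s t ∧ l ≠ i ∧
        (l ≤ j ∧ j < l + copySize k s t) := by
      by_cases h : i < j ∧ i < copySize k s t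
      · exact ⟨i + 1, by omega, by omega, by omega, by omega⟩
      · exact ⟨i - 1, by omega, by omega, by omega, by omega⟩
    exact ⟨t, l, .of_le_copySize hp.1 hl1 hlm, by simpa using hli,
      mem_layeredEdge_self.2 ((mem_copyEdge hl1 hlm).2 hjl)⟩
  · have h4 := four_le_copySize (s := s) (p := i :: p) hk
    exact ⟨i :: p, copySize k s (i :: p),
      .of_le_copySize (hp.isCopy_cons hl) (by omega) le_rfl, by simp,
      mem_layeredEdge_self.2 (mem_copyEdge_last hk hj)⟩

/-- Two features single out this edge: it meets the fixed edge from `M*` (in `v_k`), and it has a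
vertex, `v_{2k-5}`, that lies in no other edge. Edges meeting the one from `M*` belong to the top
copy or are among the last two of its child `[k - 1]`. There `v_1` of the top copy and `v_{2m-1}` of
the child already lie in the edge from `M*`, so neither can be the image of `v_{2k-5}`. -/
theorem IsIso.mapEdge_nil_lastEdge (hφ : IsIso φ) :
    mapEdge φ (layeredEdge k s [] (k - 2)) = layeredEdge k s [] (k - 2) := by
  have hidx : IsEdgeIndex k s [] (k - 2) := isEdgeIndex_nil.2 (by omega)
  obtain ⟨p, i, hi, hmap⟩ := hφ.exists_mapEdge_layeredEdge hidx
  have hne : ¬ (p = [] ∧ i = k - 1) := by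
    rintro ⟨rfl, rfl⟩
    have := (eq_of_mapEdge_eq hidx hi hmap hφ.mapEdge_star).2
    omega
  have him := (hi.le_copySize_or hk).resolve_right hne
  have h4 := four_le_copySize (s := s) (p := p) hk
  -- the image meets the star edge
  have hmeet : p = [] ∨ p = [k - 1] ∧ copySize k s p ≤ i + 1 := by
    have hw : (([], k) : List ℕ × ℕ) ∈ layeredEdge k s [] (k - 2) :=
      mem_layeredEdge_self.2 ((mem_copyEdge_nil (by omega) le_rfl).2 (by omega))
    have hw' : (([], k) : List ℕ × ℕ) ∈ layeredEdge k s [] (k - 1) :=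
      mem_layeredEdge_self.2 ((mem_copyEdge_star hk).2 (by omega))
    let w : V(layered k s hk) := ⟨([], k), mem_vertexSet_of_mem_edgeSet (hidx.mem_edgeSet hk) hw⟩
    have h1 : (φ w : List ℕ × ℕ) ∈ layeredEdge k s p i := hmap ▸ (mem_mapEdge w).2 hw
    have h2 : (φ w : List ℕ × ℕ) ∈ layeredEdge k s [] (k - 1) :=
      hφ.mapEdge_star ▸ (mem_mapEdge w).2 hw'
    generalize (φ w : List ℕ × ℕ) = y at h1 h2
    obtain ⟨t, j⟩ := y
    rcases mem_layeredEdge.1 h2 with ⟨rfl, -⟩ | ⟨-, rfl, hj⟩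
    · rcases mem_layeredEdge.1 h1 with ⟨h, -⟩ | ⟨-, h, -⟩
      · exact .inl h.symm
      · simp at h
    · rcases mem_layeredEdge.1 h1 with ⟨rfl, hj'⟩ | ⟨-, h, -⟩
      · rw [mem_copyLastTwo] at hj
        rw [mem_copyEdge hi.2.1 him] at hj'
        exact .inr ⟨rfl, by omega⟩
      · obtain ⟨rfl, rfl⟩ := List.cons_eq_cons.1 h
        exact (hne ⟨rfl, rfl⟩).elim
  by_contra hcon
  -- the vertex `v_{2m-1}` of the top copy lies in no other edge
  have hu : (([], 2 * (k - 2) - 1) : List ℕ × ℕ) ∈ layeredEdge k s [] (k - 2) :=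
    mem_layeredEdge_self.2 ((mem_copyEdge_nil (by omega) le_rfl).2 (by omega))
  let u : V(layered k s hk) :=
    ⟨([], 2 * (k - 2) - 1), mem_vertexSet_of_mem_edgeSet (hidx.mem_edgeSet hk) hu⟩
  have huonly : ∀ q l, IsEdgeIndex k s q l → (φ u : List ℕ × ℕ) ∈ layeredEdge k s q l →
      (q, l) = (p, i) := by
    intro q l hl hmem
    obtain ⟨f, hf, hfmap⟩ := hφ.exists_mapEdge_eq (hl.mem_edgeSet hk)
    rw [← hfmap, mem_mapEdge] at hmem
    obtain ⟨t, c, hc, rfl⟩ := (mem_edgeSet_layered hk).1 hf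
    have htc : t = [] ∧ c = k - 2 := by
      rcases mem_layeredEdge.1 hmem with ⟨rfl, hj⟩ | ⟨-, h, -⟩
      · refine ⟨rfl, ?_⟩
        rcases hc.le_copySize_or hk with hcm | ⟨-, rfl⟩
        · rw [mem_copyEdge hc.2.1 hcm] at hj
          rw [copySize_nil] at hj hcm
          omega
        · rw [mem_copyEdge_star hk] at hj
          omega
      · simp at h
    obtain ⟨rfl, rfl⟩ := htc
    obtain ⟨rfl, rfl⟩ := layeredEdge_injective hk hi hl (hmap.symm.trans hfmap)
    rfl
  have hφu : (φ u : List ℕ × ℕ) ∈ layeredEdge k s p i := hmap ▸ (mem_mapEdge u).2 hu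
  have hstar : (φ u : List ℕ × ℕ) ∉ layeredEdge k s [] (k - 1) := fun h =>
    hne (by simpa [eq_comm] using huonly [] (k - 1) (isEdgeIndex_star hk) h)
  have hends : (φ u : List ℕ × ℕ) = (p, 1) ∨ (φ u : List ℕ × ℕ) = (p, 2 * copySize k s p - 1) := by
    by_contra! h
    obtain ⟨q, l, hl, hql, hmem⟩ := exists_other_edge hk hi him hφu h.1 h.2
    exact hql (huonly q l hl hmem)
  rcases hmeet with rfl | ⟨rfl, him'⟩
  · rcases hends with h | h
    · rw [h, mem_layeredEdge_self, mem_copyEdge_star hk] at hstar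
      omega
    · rw [h, mem_layeredEdge_self, mem_copyEdge hi.2.1 him] at hφu
      rw [copySize_nil] at hφu him
      obtain rfl : i = k - 2 := by omega
      exact hcon hmap
  · rcases hends with h | h
    · rw [h, mem_layeredEdge_self, mem_copyEdge hi.2.1 him] at hφu
      omega
    · refine hstar ?_
      rw [h, mem_layeredEdge]
      exact .inr ⟨by simp, rfl, mem_copyLastTwo.2 (.inr rfl)⟩

/-- The last two vertices of `c :: p` go to common vertices of the fixed edge `(p, c)` and the image
edge. The image edge cannot be one already known to be fixed, which excludes common vertices in the
copy `p`. So both images are again the last two vertices, and only `M_m` contains both. -/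
theorem IsIso.mapEdge_child_lastEdge (hφ : IsIso φ) {c : ℕ} (hc : IsCopy k s (c :: p))
    (hfix : ∀ i, IsEdgeIndex k s p i → mapEdge φ (layeredEdge k s p i) = layeredEdge k s p i)
    (hup : ∀ i t, p = i :: t → mapEdge φ (layeredEdge k s t i) = layeredEdge k s t i) :
    mapEdge φ (layeredEdge k s (c :: p) (copySize k s (c :: p))) =
      layeredEdge k s (c :: p) (copySize k s (c :: p)) := by
  have h4 := four_le_copySize (s := s) (p := c :: p) hk
  have hidx : IsEdgeIndex k s (c :: p) (copySize k s (c :: p)) :=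
    .of_le_copySize hc (by omega) le_rfl
  obtain ⟨t, i, hi, hmap⟩ := hφ.exists_mapEdge_layeredEdge hidx
  have hnotfix : mapEdge φ (layeredEdge k s t i) = layeredEdge k s t i →
      c :: p = t ∧ copySize k s (c :: p) = i := eq_of_mapEdge_eq hidx hi hmap
  have hlp : p.length ≠ s + 1 := by have := hc.length_le_of_cons; omega
  have hcommon : ∀ x : V(layered k s hk), ∀ j ∈ copyLastTwo k s (c :: p),
      (x : List ℕ × ℕ) = (c :: p, j) → t = c :: p ∧ ∃ l ∈ copyLastTwo k s (c :: p),
        l ∈ copyEdge k s t i ∧ (φ x : List ℕ × ℕ) = (c :: p, l) := by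
    intro x j hj hxj
    have h1 : (φ x : List ℕ × ℕ) ∈ layeredEdge k s p c := by
      rw [← hfix c hc.isEdgeIndex, mem_mapEdge, hxj]
      exact mem_layeredEdge.2 (.inr ⟨hlp, rfl, hj⟩)
    have h2 : (φ x : List ℕ × ℕ) ∈ layeredEdge k s t i := by
      rw [← hmap, mem_mapEdge, hxj]
      exact mem_layeredEdge_self.2 (mem_copyEdge_last hk hj)
    generalize (φ x : List ℕ × ℕ) = y at h1 h2
    obtain ⟨u, l⟩ := y
    rcases mem_layeredEdge.1 h1 with ⟨rfl, -⟩ | ⟨-, rfl, hl⟩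
    · rcases mem_layeredEdge.1 h2 with ⟨rfl, -⟩ | ⟨-, h, -⟩
      · simpa using (hnotfix (hfix i hi)).1
      · have h3 := congrArg List.length (hnotfix (hup i t h)).1
        have h5 := congrArg List.length h
        simp only [List.length_cons] at h3 h5
        omega
    · rcases mem_layeredEdge.1 h2 with ⟨h, hl'⟩ | ⟨-, h, -⟩
      · exact ⟨h.symm, l, hl, hl', rfl⟩
      · obtain ⟨rfl, rfl⟩ := List.cons_eq_cons.1 h
        simpa using (hnotfix (hfix c hi)).1
  have hV : ∀ j ∈ copyLastTwo k s (c :: p), (c :: p, j) ∈ V(layered k s hk) := fun j hj =>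
    mem_vertexSet_of_mem_edgeSet (hidx.mem_edgeSet hk)
      (mem_layeredEdge_self.2 (mem_copyEdge_last hk hj))
  have hj₁ : 2 * copySize k s (c :: p) - 2 ∈ copyLastTwo k s (c :: p) :=
    mem_copyLastTwo.2 (.inl rfl)
  have hj₂ : 2 * copySize k s (c :: p) - 1 ∈ copyLastTwo k s (c :: p) :=
    mem_copyLastTwo.2 (.inr rfl)
  obtain ⟨rfl, l₁, hl₁, hl₁', hφ₁⟩ := hcommon ⟨_, hV _ hj₁⟩ _ hj₁ rfl
  obtain ⟨-, l₂, hl₂, hl₂', hφ₂⟩ := hcommon ⟨_, hV _ hj₂⟩ _ hj₂ rfl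
  have hl : l₁ ≠ l₂ := by
    rintro rfl
    have := congrArg Subtype.val (φ.injective (Subtype.ext (hφ₁.trans hφ₂.symm)))
    simp only [Prod.mk.injEq, true_and] at this
    omega
  have him : i ≤ copySize k s (c :: p) := (hi.le_copySize_or hk).resolve_right (by simp)
  rw [mem_copyLastTwo] at hl₁ hl₂
  rw [mem_copyEdge hi.2.1 him] at hl₁' hl₂'
  obtain rfl : i = copySize k s (c :: p) := by omega
  exact hmap

theorem IsIso.mapEdge_layeredEdge (hφ : IsIso φ) (hp : IsCopy k s p) :
    (∀ i, IsEdgeIndex k s p i → mapEdge φ (layeredEdge k s p i) = layeredEdge k s p i) ∧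
      ∀ i t, p = i :: t → mapEdge φ (layeredEdge k s t i) = layeredEdge k s t i := by
  induction hp with
  | nil =>
    refine ⟨fun i hi => ?_, by simp⟩
    rcases hi.le_copySize_or hk with him | ⟨-, rfl⟩
    · refine hφ.mapEdge_of_lastEdge .nil ?_ hi.2.1 him
      rw [copySize_nil]
      exact hφ.mapEdge_nil_lastEdge
    · exact hφ.mapEdge_star
  | cons c p hp hl hc hc' ih =>
    have hcopy : IsCopy k s (c :: p) := .cons c p hp hl hc hc'
    refine ⟨fun i hi => ?_, fun i t h => ?_⟩
    · exact hφ.mapEdge_of_lastEdge hcopy (hφ.mapEdge_child_lastEdge hcopy ih.1 ih.2) hi.2.1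
        ((hi.le_copySize_or hk).resolve_right (by simp))
    · obtain ⟨rfl, rfl⟩ := List.cons_eq_cons.1 h
      exact ih.1 c hcopy.isEdgeIndex

theorem isAsymmetric_layered (hk : 6 ≤ k) : (layered k s hk).IsAsymmetric := by
  intro φ hφ
  refine eq_refl_of_mapEdge_eq (fun x hx y hy => eq_of_forall_mem_iff hk hx hy) fun e he => ?_
  obtain ⟨p, i, hi, rfl⟩ := (mem_edgeSet_layered hk).1 he
  exact (hφ.mapEdge_layeredEdge hi.1).1 i hi

end Asymmetric

end Hypergraph

theorem theorem4 (k : ℕ) (hk : 6 ≤ k) :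
    (∀ s : ℕ,
      (Hypergraph.layered k s hk).IsKGraph k ∧
      (Hypergraph.layered k s hk).IsAsymmetric ∧
      ∀ H : Hypergraph (List ℕ × ℕ),
        H.IsSubhypergraph (Hypergraph.layered k s hk) → H ≠ Hypergraph.layered k s hk →
        2 ≤ H.vertexSet.ncard → H.HasInvolution) ∧
    ∀ s t : ℕ, s ≠ t →
      ¬ (Hypergraph.layered k s hk).Isomorphic (Hypergraph.layered k t hk) := by
  refine ⟨fun s => ⟨Hypergraph.isKGraph_layered hk, Hypergraph.isAsymmetric_layered hk,
    fun H hH hne h2 => Hypergraph.hasInvolution_of_ne_layered hH hne h2⟩,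
    fun s t hst => Hypergraph.not_isomorphic_layered hk hst⟩
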